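/- Call a bounded connected set $K\subset\mathbb R^2$ with non-empty interior a \emph{mesh cell} if its boundary $\partial K$ is a Lipschitz boundary and is a simple closed contour consisting of at least two, and finitely many, smooth arcs (with $C^1$ parametrizations of nonvanishing velocity), where adjacent arcs meet at an interior angle strictly between $0$ and $2\pi$. Write $h_K$ for the diameter of $K$, $\mathbb P_m(K)$ for the polynomials on $K$ of total degree at most $m$ (with $\mathbb P_m(K)=\{0\}$ for $m<0$), and $H^k(K)$ for the Sobolev space of real functions with weak derivatives up to order $k$ in $L^2$ on the interior of $K$, with seminorm $|f|_{H^k(K)}=\bigl(\sum_{|\alpha|=k}\|\partial^\alpha f\|_{L^2(K)}^2\bigr)^{1/2}$. Let $p\ge 1$ be an integer, and let $v\in H^1(K)$ have a distributional Laplacian $\Delta v\in H^{p-1}(K)$. Let $v^K\in H^1_0(K)$ be the weak solution of $\Delta v^K=\Delta v$ in $K$, $v^K=0$ on $\partial K$. Let $q^K\in\mathbb P_{p-2}(K)$ be the $L^2(K)$-projection of $\Delta v$, that is, $\int_K(\Delta v-q^K)\phi\,dx=0$ for all $\phi\in\mathbb P_{p-2}(K)$, and let $\mathcal I_K^Kv\in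 H^1_0(K)$ be the weak solution of $\Delta(\mathcal I_K^Kv)=q^K$ in $K$, $\mathcal I_K^Kv=0$ on $\partial K$. \textbf{Proposition.} The functions $v^K$ and $\mathcal I_K^Kv$ exist, and there is a constant $c=c(p,K)>0$, independent of $v$, for which $$|v^K-\mathcal I_K^Kv|_{H^1(K)}\le c\,h_K^{p}\,|\Delta v|_{H^{p-1}(K)},\qquad \|v^K-\mathcal I_K^Kv\|_{L^2(K)}\le c\,h_K^{p+1}\,|\Delta v|_{H^{p-1}(K)}.$$ The constant is scale-invariant: for given $p$ and $K$, one constant $c$ serves all the cells $z+sK$ with $s>0$ and $z\in\mathbb R^2$, and all admissible functions $v$ on them. -/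

import Mathlib

open MeasureTheory Set TopologicalSpace Filter Topology
open scoped NNReal ContDiff Distributions LineDeriv

namespace CurvedFEM

/-- The Euclidean plane. -/
abbrev Plane : Type := EuclideanSpace ℝ (Fin 2)

/-- The coordinate unit vectors. -/
noncomputable def unitVec (i : Fin 2) : Plane := EuclideanSpace.single i 1

/-! ### Mesh cells -/

/-- `K` has a Lipschitz boundary: near each boundary point, after a rigid motion that moves this
point to the origin, the interior of `K` is the set of points above the graph of a Lipschitz
function, and the boundary of `K` is the graph. -/
def HasLipschitzBoundary (K : Set Plane) : Prop :=
  ∀ x ∈ frontier K, ∃ (e : Plane ≃ₗᵢ[ℝ] Plane) (L : ℝ≥0) (φ : ℝ → ℝ) (r : ℝ),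
    0 < r ∧ LipschitzWith L φ ∧
      ∀ y : Plane, |y 0| < r → |y 1| < r →
        (x + e y ∈ interior K ↔ φ (y 0) < y 1) ∧ (x + e y ∈ frontier K ↔ y 1 = φ (y 0))

/-- The set `J` is a simple closed contour, consisting of finitely many (at least two) smooth arcs,
the edges `γ 0, …, γ (n + 1)`, each parametrized over `[0, 1]` and cyclically indexed by
`Fin (n + 2)`. A smooth arc is one with a continuously differentiable parametrization of
nonvanishing velocity; this covers arcs of any higher smoothness. -/
structure IsCurvilinearPolygon (J : Set Plane) {n : ℕ} (γ : Fin (n + 2) → ℝ → Plane) : Prop where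
  smooth : ∀ i, ContDiffOn ℝ 1 (γ i) (Icc 0 1)
  regular : ∀ i, ∀ t ∈ Icc (0 : ℝ) 1, derivWithin (γ i) (Icc 0 1) t ≠ 0
  /-- each edge ends where the next one begins -/
  chain : ∀ i, γ i 1 = γ (i + 1) 0
  /-- no point is passed twice in one traversal of the contour -/
  simple : ∀ i j, ∀ s ∈ Ico (0 : ℝ) 1, ∀ t ∈ Ico (0 : ℝ) 1, γ i s = γ j t → i = j ∧ s = t
  /-- adjacent edges do not meet at an angle `0` or `2π`: the contour never reverses its direction
  (straight angles are allowed) -/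
  no_cusp : ∀ i, ¬ SameRay ℝ (derivWithin (γ i) (Icc 0 1) 1)
    (-derivWithin (γ (i + 1)) (Icc 0 1) 0)
  union : J = ⋃ i, γ i '' Icc 0 1

/-- Mesh cells. A mesh cell has no holes, since its boundary is a single closed contour. -/
structure IsMeshCell (K : Set Plane) : Prop where
  connected : IsConnected K
  interior_nonempty : (interior K).Nonempty
  compact_closure : IsCompact (closure K)
  lipschitz : HasLipschitzBoundary K
  boundary : ∃ (n : ℕ) (γ : Fin (n + 2) → ℝ → Plane), IsCurvilinearPolygon (frontier K) γ

/-- The image of `K` under the dilation-translation `x ↦ z + s x`. -/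
def rescale (z : Plane) (s : ℝ) (K : Set Plane) : Set Plane := (fun x => z + s • x) '' K

/-! ### Sobolev spaces on open subsets of the plane -/

/-- The classical partial derivative `∂₁^α₁ ∂₂^α₂ φ` of a test function. -/
noncomputable def testDeriv {Ω : Opens Plane} (α : ℕ × ℕ) (φ : 𝓓(Ω, ℝ)) : 𝓓(Ω, ℝ) :=
  (fun ψ : 𝓓(Ω, ℝ) => ∂_{unitVec 0} ψ)^[α.1] ((fun ψ : 𝓓(Ω, ℝ) => ∂_{unitVec 1} ψ)^[α.2] φ)

/-- `g` is the weak partial derivative `∂^α f` on `Ω`. -/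
def HasWeakDeriv (Ω : Opens Plane) (α : ℕ × ℕ) (f g : Plane → ℝ) : Prop :=
  LocallyIntegrableOn f Ω ∧ LocallyIntegrableOn g Ω ∧
    ∀ φ : 𝓓(Ω, ℝ), ∫ x in Ω, f x * testDeriv α φ x = (-1) ^ (α.1 + α.2) * ∫ x in Ω, g x * φ x

/-- `g` is the distributional Laplacian of `f` on `Ω`. -/
def HasWeakLaplacian (Ω : Opens Plane) (f g : Plane → ℝ) : Prop :=
  LocallyIntegrableOn f Ω ∧ LocallyIntegrableOn g Ω ∧
    ∀ φ : 𝓓(Ω, ℝ),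
      ∫ x in Ω, f x * (testDeriv (2, 0) φ x + testDeriv (0, 2) φ x) = ∫ x in Ω, g x * φ x

/-- Square integrable functions on `Ω`. -/
def MemL2 (Ω : Opens Plane) (f : Plane → ℝ) : Prop := MemLp f 2 (volume.restrict Ω)

/-- The norm of `L²(Ω)`. -/
noncomputable def l2Norm (Ω : Opens Plane) (f : Plane → ℝ) : ℝ := lpNorm f 2 (volume.restrict Ω)

/-- `f ∈ H^k(Ω)`. -/
def MemH (k : ℕ) (Ω : Opens Plane) (f : Plane → ℝ) : Prop :=
  MemL2 Ω f ∧ ∀ α : ℕ × ℕ, α.1 + α.2 ≤ k → ∃ g, MemL2 Ω g ∧ HasWeakDeriv Ω α f g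

open Classical in
/-- The weak derivative `∂^α f` (unique up to a null set) if it exists in `L²(Ω)`. -/
noncomputable def weakDeriv (Ω : Opens Plane) (α : ℕ × ℕ) (f : Plane → ℝ) : Plane → ℝ :=
  if h : ∃ g, MemL2 Ω g ∧ HasWeakDeriv Ω α f g then h.choose else 0

/-- The seminorm `|f|_{H^k(Ω)} = (∑_{|α| = k} ‖∂^α f‖²_{L²(Ω)})^{1/2}`, for `f ∈ H^k(Ω)`. -/
noncomputable def sobolevSeminorm (k : ℕ) (Ω : Opens Plane) (f : Plane → ℝ) : ℝ :=
  √(∑ α ∈ Finset.HasAntidiagonal.antidiagonal k, l2Norm Ω (weakDeriv Ω α f) ^ 2)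

/-- `u ∈ H¹₀(Ω)`: the function `u ∈ H¹(Ω)` is a limit of test functions in `H¹(Ω)`. -/
def MemH10 (Ω : Opens Plane) (u : Plane → ℝ) : Prop :=
  MemH 1 Ω u ∧ ∃ φ : ℕ → 𝓓(Ω, ℝ),
    Tendsto (fun n => l2Norm Ω (fun x => φ n x - u x)) atTop (𝓝 0) ∧
    Tendsto (fun n => sobolevSeminorm 1 Ω (fun x => φ n x - u x)) atTop (𝓝 0)

/-! ### The interior part of a function and its interpolant -/

/-- `w` is the weak solution in `H¹(Ω)` of `Δ w = g` in `Ω`, `w = 0` on `∂Ω`. -/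
def SolvesDirichlet (Ω : Opens Plane) (g w : Plane → ℝ) : Prop :=
  MemH10 Ω w ∧ HasWeakLaplacian Ω w g

/-- The real polynomials in two variables of total degree at most `m`; only `0` if `m < 0`. -/
def polysDegreeLE (m : ℤ) : Set (MvPolynomial (Fin 2) ℝ) :=
  {q | ∀ d ∈ q.support, (d.degree : ℤ) ≤ m}

/-- The function on the plane given by a polynomial. -/
noncomputable def polyFun (q : MvPolynomial (Fin 2) ℝ) (x : Plane) : ℝ :=
  MvPolynomial.eval (fun i => x i) q

/-- `q` is the `L²(Ω)`-projection of `g` on the polynomials of degree at most `m`. -/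
def IsL2Projection (Ω : Opens Plane) (m : ℤ) (g : Plane → ℝ) (q : MvPolynomial (Fin 2) ℝ) : Prop :=
  q ∈ polysDegreeLE m ∧
    ∀ φ ∈ polysDegreeLE m, ∫ x in Ω, (g x - polyFun q x) * polyFun φ x = 0

/-- `w` is the interior interpolant of a function whose Laplacian is `g`: it vanishes on the
boundary, and its Laplacian is the `L²`-projection of `g` on the polynomials of degree at most
`p - 2`. -/
def IsInteriorInterpolant (Ω : Opens Plane) (p : ℕ) (g w : Plane → ℝ) : Prop :=
  ∃ q, IsL2Projection Ω ((p : ℤ) - 2) g q ∧ SolvesDirichlet Ω (polyFun q) w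

end CurvedFEM

namespace CurvedFEM
open scoped ENNReal

/-! The difference of the two solutions lies in H¹₀ and has Laplacian Δv − q. Testing with the
difference itself and using the Poincaré–Friedrichs inequality bounds its energy seminorm by 2h‖Δv −
q‖ and its L² norm by (2h)²‖Δv − q‖ (`SolvesDirichlet.sub_le`). The projection q is a best L²
approximation (`IsL2Projection.l2Norm_sub_le`), so ‖Δv − q‖ is at most the Deny–Lions error, of
order s^(p-1) times the seminorm of Δv (`exists_polynomial_approximation`); s is the ratio of the
diameters. Existence is Lax–Milgram (`exists_solvesDirichlet`) together with orthogonal projection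
onto a finite-dimensional space (`exists_isL2Projection`).

Deny–Lions follows by induction on the order from a Poincaré inequality on Lipschitz domains, which
is proved through increments, without a compact embedding. A Sobolev function satisfies
`TranslationBound` because it is the integral of its gradient along almost every segment
(`ae_sub_eq_integral_of_weak_deriv`). In a box above a Lipschitz graph, a vertical and then a
horizontal segment lead from any point to any point of a rectangle above the graph, so the box and
the rectangle are `Linked` (`linked_graphBox`). Links compose through sets of positive measure,
hence connectedness and compactness of the closure spread them over the whole interior
(`linked_interior`).

The constant of a link does not depend on the function, and in the plane the Dirichlet integral is
invariant under dilations (`TranslationBound.comp_affine`). Therefore one constant serves all the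
rescaled cells. -/

/-! ### Linked sets and their calculus -/

/-- `E` bounds the squared `L²`-norms of the increments of `U` along segments inside `Ω`. For a
Sobolev function `U` this holds with the Dirichlet integral as `E`. -/
def TranslationBound (Ω : Set Plane) (U : Plane → ℝ) (E : ℝ≥0∞) : Prop :=
  ∀ (A : Set Plane) (h : Plane), IsOpen A → (∀ x ∈ A, ∀ t ∈ Icc (0 : ℝ) 1, x + t • h ∈ Ω) →
    ∫⁻ x in A, ‖U (x + h) - U x‖ₑ ^ 2 ≤ ‖h‖ₑ ^ 2 * E

/-- The mean square difference of the values on `A` and on `B` is controlled by the energy in `Ω`. -/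
def Linked (Ω A B : Set Plane) : Prop :=
  ∃ C : ℝ≥0, ∀ (U : Plane → ℝ) (E : ℝ≥0∞), Measurable U → TranslationBound Ω U E →
    ∫⁻ x in A, ∫⁻ y in B, ‖U x - U y‖ₑ ^ 2 ≤ C * E

lemma enorm_sq_eq_ofReal (r : ℝ) : ‖r‖ₑ ^ 2 = ENNReal.ofReal (r ^ 2) := by
  rw [← sq_abs, ENNReal.ofReal_pow (abs_nonneg r), ← Real.norm_eq_abs, ofReal_norm]

lemma enorm_sub_sq_le (a b c : ℝ) : ‖a - c‖ₑ ^ 2 ≤ 2 * ‖a - b‖ₑ ^ 2 + 2 * ‖b - c‖ₑ ^ 2 := by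
  simp only [enorm_sq_eq_ofReal]
  rw [← ENNReal.ofReal_ofNat 2, ← ENNReal.ofReal_mul (by norm_num),
    ← ENNReal.ofReal_mul (by norm_num), ← ENNReal.ofReal_add (by positivity) (by positivity)]
  apply ENNReal.ofReal_le_ofReal
  nlinarith [sq_nonneg (a - b - (b - c))]

lemma lt_add_mul_of_lt {p y k t : ℝ} (ht : t ∈ Icc (0 : ℝ) 1) (h : p < y) (h' : p < y + k) :
    p < y + t * k := by
  rcases le_or_gt 0 k with hk | hk
  · nlinarith [mul_nonneg ht.1 hk]
  · nlinarith [mul_nonneg (sub_nonneg.2 ht.2) (neg_nonneg.2 hk.le)]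

lemma add_mul_lt_of_lt {p y k t : ℝ} (ht : t ∈ Icc (0 : ℝ) 1) (h : y < p) (h' : y + k < p) :
    y + t * k < p := by
  have := lt_add_mul_of_lt (p := -p) (y := -y) (k := -k) ht (by linarith) (by linarith)
  linarith

lemma measurable_enorm_sub_sq {U : Plane → ℝ} (hU : Measurable U) :
    Measurable (fun z : Plane × Plane => ‖U z.1 - U z.2‖ₑ ^ 2) := by
  fun_prop

namespace Linked

variable {Ω A A' B B' C : Set Plane}

lemma symm (h : Linked Ω A B) : Linked Ω B A := by
  obtain ⟨c, hc⟩ := h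
  refine ⟨c, fun U E hU hE => ?_⟩
  rw [lintegral_lintegral_swap (measurable_enorm_sub_sq hU).aemeasurable]
  simpa only [enorm_sub_rev] using hc U E hU hE

lemma mono (h : Linked Ω A B) (hA : A' ⊆ A) (hB : B' ⊆ B) : Linked Ω A' B' := by
  obtain ⟨c, hc⟩ := h
  refine ⟨c, fun U E hU hE => le_trans ?_ (hc U E hU hE)⟩
  exact (lintegral_mono_set hA).trans (lintegral_mono fun x => lintegral_mono_set hB)

lemma union (h : Linked Ω A B) (h' : Linked Ω A' B) : Linked Ω (A ∪ A') B := by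
  obtain ⟨c, hc⟩ := h
  obtain ⟨c', hc'⟩ := h'
  refine ⟨c + c', fun U E hU hE => (lintegral_union_le _ _ _).trans ?_⟩
  rw [ENNReal.coe_add, add_mul]
  exact add_le_add (hc U E hU hE) (hc' U E hU hE)

/-- Insert an intermediate value U y, average over y in B, and use |a − c|² ≤ 2|a − b|² + 2|b − c|².
Averaging is why B must have positive finite measure. -/
lemma trans (h : Linked Ω A B) (h' : Linked Ω B C) (hA : volume A ≠ ⊤) (hB : volume B ≠ ⊤)
    (hB0 : volume B ≠ 0) (hC : volume C ≠ ⊤) : Linked Ω A C := by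
  obtain ⟨c, hc⟩ := h
  obtain ⟨c', hc'⟩ := h'.symm
  set X : ℝ≥0∞ := 2 * (volume C * c) + 2 * (volume A * c') with hX
  have hfin : X / volume B ≠ ⊤ := by
    refine ENNReal.div_ne_top ?_ hB0
    exact ENNReal.add_ne_top.2 ⟨ENNReal.mul_ne_top (by simp) (ENNReal.mul_ne_top hC (by simp)),
      ENNReal.mul_ne_top (by simp) (ENNReal.mul_ne_top hA (by simp))⟩
  refine ⟨(X / volume B).toNNReal, fun U E hU hE => ?_⟩
  rw [ENNReal.coe_toNNReal hfin, ← ENNReal.mul_div_right_comm,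
    ENNReal.le_div_iff_mul_le (.inl hB0) (.inl hB)]
  have hm1 : ∀ y, Measurable fun x => ‖U x - U y‖ₑ ^ 2 := fun y => by fun_prop
  have hm2 : ∀ x, Measurable fun y => ‖U x - U y‖ₑ ^ 2 := fun y => by fun_prop
  have hm3 : ∀ S : Set Plane, Measurable fun x => ∫⁻ y in S, ‖U x - U y‖ₑ ^ 2 := fun S =>
    (measurable_enorm_sub_sq hU).lintegral_prod_right'
  calc (∫⁻ x in A, ∫⁻ z in C, ‖U x - U z‖ₑ ^ 2) * volume B
      = ∫⁻ x in A, ∫⁻ z in C, ∫⁻ _ in B, ‖U x - U z‖ₑ ^ 2 := by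
        rw [← lintegral_mul_const _ (hm3 C)]
        refine lintegral_congr fun x => ?_
        rw [← lintegral_mul_const _ (hm2 x)]
        refine lintegral_congr fun z => ?_
        rw [setLIntegral_const]
    _ ≤ ∫⁻ x in A, ∫⁻ z in C, ∫⁻ y in B, (2 * ‖U x - U y‖ₑ ^ 2 + 2 * ‖U z - U y‖ₑ ^ 2) := by
        refine lintegral_mono fun x => lintegral_mono fun z => lintegral_mono fun y => ?_
        dsimp only
        rw [← enorm_sub_rev (U y) (U z)]
        exact enorm_sub_sq_le _ _ _
    _ = ∫⁻ x in A, ∫⁻ z in C, (2 * (∫⁻ y in B, ‖U x - U y‖ₑ ^ 2)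
          + 2 * (∫⁻ y in B, ‖U z - U y‖ₑ ^ 2)) := by
        refine lintegral_congr fun x => lintegral_congr fun z => ?_
        rw [lintegral_add_left ((hm2 x).const_mul 2), lintegral_const_mul _ (hm2 x),
          lintegral_const_mul _ (hm2 z)]
    _ = 2 * (volume C * ∫⁻ x in A, ∫⁻ y in B, ‖U x - U y‖ₑ ^ 2)
          + 2 * (volume A * ∫⁻ z in C, ∫⁻ y in B, ‖U z - U y‖ₑ ^ 2) := by
        have : ∀ x, ∫⁻ z in C, (2 * (∫⁻ y in B, ‖U x - U y‖ₑ ^ 2)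
            + 2 * (∫⁻ y in B, ‖U z - U y‖ₑ ^ 2)) =
            2 * volume C * (∫⁻ y in B, ‖U x - U y‖ₑ ^ 2)
            + 2 * ∫⁻ z in C, ∫⁻ y in B, ‖U z - U y‖ₑ ^ 2 := fun x => by
          rw [lintegral_add_left measurable_const, setLIntegral_const,
            lintegral_const_mul _ (hm3 B)]
          ring
        simp_rw [this]
        rw [lintegral_add_right _ measurable_const, setLIntegral_const,
          lintegral_const_mul _ (hm3 B)]
        ring
    _ ≤ 2 * (volume C * (c * E)) + 2 * (volume A * (c' * E)) := by
        gcongr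
        · exact hc U E hU hE
        · exact hc' U E hU hE
    _ = X * E := by rw [hX]; ring

end Linked

/-! ### Local links: boxes above Lipschitz graphs -/

/-- The part of a strip below height `b` and above the graph of `φ`, in the coordinates given by
the rigid motion `y ↦ x₀ + e y`. -/
def graphBox (x₀ : Plane) (e : Plane ≃ₗᵢ[ℝ] Plane) (a : ℝ) (φ : ℝ → ℝ) (b : ℝ) : Set Plane :=
  {x | |e.symm (x - x₀) 0| < a ∧ φ (e.symm (x - x₀) 0) < e.symm (x - x₀) 1 ∧
    e.symm (x - x₀) 1 < b}

lemma isOpen_graphBox (x₀ : Plane) (e : Plane ≃ₗᵢ[ℝ] Plane) (a : ℝ) {φ : ℝ → ℝ}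
    (hφ : Continuous φ) (b : ℝ) : IsOpen (graphBox x₀ e a φ b) := by
  have h : ∀ i, Continuous fun x : Plane => e.symm (x - x₀) i := fun i => by fun_prop
  exact (isOpen_lt (h 0).abs continuous_const).inter
    ((isOpen_lt (hφ.comp (h 0)) (h 1)).inter (isOpen_lt (h 1) continuous_const))

lemma lintegral_increment_le {Ω : Set Plane} {U : Plane → ℝ} {E : ℝ≥0∞} (hU : Measurable U)
    (hE : TranslationBound Ω U E) {A : Set Plane} (hA : IsOpen A) (v w : Plane)
    (hv : ∀ x ∈ A, ∀ t ∈ Icc (0 : ℝ) 1, x + t • v ∈ Ω)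
    (hw : ∀ x ∈ A, ∀ t ∈ Icc (0 : ℝ) 1, x + v + t • w ∈ Ω) :
    ∫⁻ x in A, ‖U x - U (x + (v + w))‖ₑ ^ 2 ≤ 2 * (‖v‖ₑ ^ 2 + ‖w‖ₑ ^ 2) * E := by
  have h1 := hE A v hA hv
  have hA' : IsOpen ((fun x => x + -v) ⁻¹' A) := hA.preimage (by fun_prop)
  -- The second leg starts at x + v, so the bound for w is applied on the translate A + v.
  have h2 : ∫⁻ x in A, ‖U (x + (v + w)) - U (x + v)‖ₑ ^ 2 ≤ ‖w‖ₑ ^ 2 * E := by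
    refine le_trans (le_of_eq ?_) (hE _ w hA' fun x hx t ht => by
      simpa using hw (x + -v) hx t ht)
    rw [← lintegral_indicator hA.measurableSet, ← lintegral_indicator hA'.measurableSet,
      ← lintegral_add_right_eq_self
        (((fun x => x + -v) ⁻¹' A).indicator fun x => ‖U (x + w) - U x‖ₑ ^ 2) v]
    refine lintegral_congr fun x => ?_
    have : x + v ∈ (fun x => x + -v) ⁻¹' A ↔ x ∈ A := by
      rw [mem_preimage, add_neg_cancel_right]
    by_cases hx : x ∈ A
    · rw [indicator_of_mem hx, indicator_of_mem (this.2 hx), add_assoc]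
    · rw [indicator_of_notMem hx, indicator_of_notMem fun h => hx (this.1 h)]
  have hm1 : Measurable fun x => ‖U (x + v) - U x‖ₑ ^ 2 := by fun_prop
  have hm2 : Measurable fun x => ‖U (x + (v + w)) - U (x + v)‖ₑ ^ 2 := by fun_prop
  calc ∫⁻ x in A, ‖U x - U (x + (v + w))‖ₑ ^ 2
      ≤ ∫⁻ x in A, (2 * ‖U (x + v) - U x‖ₑ ^ 2 + 2 * ‖U (x + (v + w)) - U (x + v)‖ₑ ^ 2) := by
        refine lintegral_mono fun x => ?_
        have := enorm_sub_sq_le (U x) (U (x + v)) (U (x + (v + w)))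
        rwa [enorm_sub_rev (U x) (U (x + v)), enorm_sub_rev (U (x + v)) (U (x + (v + w)))] at this
    _ = 2 * (∫⁻ x in A, ‖U (x + v) - U x‖ₑ ^ 2)
        + 2 * ∫⁻ x in A, ‖U (x + (v + w)) - U (x + v)‖ₑ ^ 2 := by
        rw [lintegral_add_left (hm1.const_mul 2), lintegral_const_mul _ hm1,
          lintegral_const_mul _ hm2]
    _ ≤ 2 * (‖v‖ₑ ^ 2 * E) + 2 * (‖w‖ₑ ^ 2 * E) :=
        add_le_add (mul_le_mul_right h1 2) (mul_le_mul_right h2 2)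
    _ = 2 * (‖v‖ₑ ^ 2 + ‖w‖ₑ ^ 2) * E := by ring

/-- Substituting y = x + h turns the double integral over A × B into an integral over h of squared
increments. Only the h in a ball of radius 2D contribute, where D bounds the norms of the points of
Ω. -/
lemma linked_of_increments {Ω A B : Set Plane} (hΩ : Bornology.IsBounded Ω) (hA : IsOpen A)
    (hB : IsOpen B) (hAΩ : A ⊆ Ω) (hBΩ : B ⊆ Ω) (c : ℝ≥0)
    (h : ∀ (U : Plane → ℝ) (E : ℝ≥0∞), Measurable U → TranslationBound Ω U E → ∀ h : Plane,
      ∫⁻ x in A ∩ (fun x => x + h) ⁻¹' B, ‖U x - U (x + h)‖ₑ ^ 2 ≤ c * ‖h‖ₑ ^ 2 * E) :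
    Linked Ω A B := by
  obtain ⟨D, hD⟩ := hΩ.exists_pos_norm_le
  obtain ⟨hD0, hD⟩ := hD
  have hvol : volume (Metric.closedBall (0 : Plane) (2 * D)) ≠ ⊤ :=
    (isCompact_closedBall _ _).measure_lt_top.ne
  refine ⟨c * ENNReal.toNNReal (ENNReal.ofReal (2 * D)) ^ 2 *
    (volume (Metric.closedBall (0 : Plane) (2 * D))).toNNReal, fun U E hU hE => ?_⟩
  have hm := measurable_enorm_sub_sq hU
  have hmeas : Measurable fun z : Plane × Plane =>
      A.indicator (fun x => B.indicator (fun y => ‖U x - U y‖ₑ ^ 2) z.2) z.1 := by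
    have : (fun z : Plane × Plane =>
      A.indicator (fun x => B.indicator (fun y => ‖U x - U y‖ₑ ^ 2) z.2) z.1) =
      (A ×ˢ B).indicator fun z : Plane × Plane => ‖U z.1 - U z.2‖ₑ ^ 2 := by
      ext z
      by_cases h1 : z.1 ∈ A <;> by_cases h2 : z.2 ∈ B <;> simp [indicator, h1, h2]
    rw [this]
    exact hm.indicator (hA.measurableSet.prod hB.measurableSet)
  calc ∫⁻ x in A, ∫⁻ y in B, ‖U x - U y‖ₑ ^ 2
      = ∫⁻ x, ∫⁻ y, A.indicator (fun x => B.indicator (fun y => ‖U x - U y‖ₑ ^ 2) y) x := by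
        rw [← lintegral_indicator hA.measurableSet]
        refine lintegral_congr fun x => ?_
        by_cases hx : x ∈ A
        · simp only [indicator_of_mem hx]
          rw [← lintegral_indicator hB.measurableSet]
        · simp [indicator_of_notMem hx]
    _ = ∫⁻ x, ∫⁻ h, A.indicator (fun x => B.indicator (fun y => ‖U x - U y‖ₑ ^ 2) (x + h)) x := by
        refine lintegral_congr fun x => ?_
        exact (lintegral_add_left_eq_self _ x).symm
    _ = ∫⁻ h, ∫⁻ x, A.indicator (fun x => B.indicator (fun y => ‖U x - U y‖ₑ ^ 2) (x + h)) x := by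
        refine lintegral_lintegral_swap (Measurable.aemeasurable ?_)
        exact hmeas.comp (measurable_fst.prodMk (measurable_fst.add measurable_snd))
    _ = ∫⁻ h, ∫⁻ x in A ∩ (fun x => x + h) ⁻¹' B, ‖U x - U (x + h)‖ₑ ^ 2 := by
        refine lintegral_congr fun h => ?_
        rw [← lintegral_indicator
          (hA.measurableSet.inter (hB.measurableSet.preimage (measurable_add_const h)))]
        refine lintegral_congr fun x => ?_
        by_cases h1 : x ∈ A <;> by_cases h2 : x + h ∈ B <;> simp [indicator, h1, h2]
    _ ≤ ∫⁻ h, (Metric.closedBall (0 : Plane) (2 * D)).indicator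
          (fun _ => c * ENNReal.ofReal (2 * D) ^ 2 * E) h := by
        refine lintegral_mono fun h' => ?_
        by_cases hh : h' ∈ Metric.closedBall (0 : Plane) (2 * D)
        · rw [indicator_of_mem hh]
          refine (h U E hU hE h').trans ?_
          gcongr
          rw [← ofReal_norm]
          exact ENNReal.ofReal_le_ofReal (by simpa using hh)
        · rw [indicator_of_notMem hh, nonpos_iff_eq_zero]
          have : A ∩ (fun x => x + h') ⁻¹' B = ∅ := by
            refine eq_empty_of_forall_notMem fun x hx => hh ?_
            have h1 := hD x (hAΩ hx.1)
            have h2 := hD _ (hBΩ hx.2)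
            rw [mem_closedBall_zero_iff]
            calc ‖h'‖ = ‖(x + h') - x‖ := by simp
              _ ≤ ‖x + h'‖ + ‖x‖ := norm_sub_le _ _
              _ ≤ 2 * D := by linarith
          simp [this]
    _ = _ := by
        rw [lintegral_indicator measurableSet_closedBall, setLIntegral_const]
        push_cast
        rw [ENNReal.coe_toNNReal hvol, ENNReal.coe_toNNReal ENNReal.ofReal_ne_top]
        ring

lemma linked_graphBox {Ω : Set Plane} (hΩ : Bornology.IsBounded Ω) (x₀ : Plane)
    (e : Plane ≃ₗᵢ[ℝ] Plane) {a b c : ℝ} {φ : ℝ → ℝ} (hφ : Continuous φ)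
    (hc : ∀ s, |s| < a → φ s ≤ c) (hV : graphBox x₀ e a φ b ⊆ Ω) :
    Linked Ω (graphBox x₀ e a φ b) (graphBox x₀ e a (fun _ => c) b) := by
  have hsub : graphBox x₀ e a (fun _ => c) b ⊆ graphBox x₀ e a φ b :=
    fun x hx => ⟨hx.1, (hc _ hx.1).trans_lt hx.2.1, hx.2.2⟩
  have hAo := isOpen_graphBox x₀ e a hφ b
  have hBo := isOpen_graphBox x₀ e a (continuous_const (y := c)) b
  -- The vertical leg v comes first, the horizontal leg w second. The vertical leg stays above the
  -- graph since both of its ends do, the target height exceeding c ≥ φ. The horizontal leg then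
  -- runs above height c. Each leg is no longer than h, whence the factor 2 · (1 + 1) = 4.
  refine linked_of_increments hΩ hAo hBo hV (hsub.trans hV) 4 fun U E hU hE h => ?_
  set k := e.symm h with hk
  set v := e (EuclideanSpace.single 1 (k 1)) with hv
  set w := e (EuclideanSpace.single 0 (k 0)) with hw
  have hvw : v + w = h := by
    rw [hv, hw, ← map_add, ← e.apply_symm_apply h, ← hk]
    congr 1
    ext i
    fin_cases i <;> simp
  have hnv : ‖v‖ₑ ≤ ‖h‖ₑ := by
    rw [← ofReal_norm, ← ofReal_norm]
    refine ENNReal.ofReal_le_ofReal ?_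
    rw [hv, e.norm_map, PiLp.norm_single, ← e.symm.norm_map h]
    exact PiLp.norm_apply_le _ _
  have hnw : ‖w‖ₑ ≤ ‖h‖ₑ := by
    rw [← ofReal_norm, ← ofReal_norm]
    refine ENNReal.ofReal_le_ofReal ?_
    rw [hw, e.norm_map, PiLp.norm_single, ← e.symm.norm_map h]
    exact PiLp.norm_apply_le _ _
  have key : ∀ x, x ∈ graphBox x₀ e a φ b ∩ (fun x => x + h) ⁻¹' graphBox x₀ e a (fun _ => c) b →
      (∀ t ∈ Icc (0 : ℝ) 1, x + t • v ∈ Ω) ∧ ∀ t ∈ Icc (0 : ℝ) 1, x + v + t • w ∈ Ω := by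
    intro x hx
    have e1 : ∀ t : ℝ, e.symm (x + t • v - x₀) =
        e.symm (x - x₀) + t • EuclideanSpace.single 1 (k 1) := fun t => by
      rw [add_sub_right_comm, map_add, map_smul, hv, e.symm_apply_apply]
    have e2 : ∀ t : ℝ, e.symm (x + v + t • w - x₀) = e.symm (x - x₀) +
        EuclideanSpace.single 1 (k 1) + t • EuclideanSpace.single 0 (k 0) := fun t => by
      rw [add_sub_right_comm, map_add, map_smul, hw, e.symm_apply_apply, add_sub_right_comm,
        map_add, hv, e.symm_apply_apply]
    have e3 : e.symm (x + h - x₀) = e.symm (x - x₀) + k := by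
      rw [add_sub_right_comm, map_add]
    obtain ⟨⟨h1, h2, h3⟩, h4, h5, h6⟩ := hx
    rw [e3] at h4 h5 h6
    set y := e.symm (x - x₀)
    simp only [PiLp.add_apply] at h4 h5 h6
    have hc1 := hc _ h1
    rw [abs_lt] at h1 h4
    constructor <;> intro t ht <;> apply hV
    · rw [graphBox, mem_ofPred_eq, e1]
      simp only [PiLp.add_apply, PiLp.smul_apply, smul_eq_mul]
      simp only [PiLp.single_apply]
      norm_num
      exact ⟨abs_lt.2 h1, lt_add_mul_of_lt ht h2 (hc1.trans_lt h5), add_mul_lt_of_lt ht h3 h6⟩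
    · apply hsub
      rw [graphBox, mem_ofPred_eq, e2]
      simp only [PiLp.add_apply, PiLp.smul_apply, smul_eq_mul]
      simp only [PiLp.single_apply]
      norm_num
      exact ⟨abs_lt.2 ⟨lt_add_mul_of_lt ht h1.1 h4.1, add_mul_lt_of_lt ht h1.2 h4.2⟩, h5, h6⟩
  have h1 := lintegral_increment_le hU hE
    (hAo.inter (hBo.preimage (continuous_add_const h))) v w
    (fun x hx => (key x hx).1) (fun x hx => (key x hx).2)
  rw [hvw] at h1
  refine h1.trans ?_
  refine mul_le_mul_left ?_ E
  calc 2 * (‖v‖ₑ ^ 2 + ‖w‖ₑ ^ 2) ≤ 2 * (‖h‖ₑ ^ 2 + ‖h‖ₑ ^ 2) := by gcongr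
    _ = _ := by push_cast; ring

lemma Linked.exists_nhds_of_mem_interior {K : Set Plane} (hK : Bornology.IsBounded (interior K))
    {x : Plane} (hx : x ∈ interior K) :
    ∃ N ∈ 𝓝 x, Linked (interior K) (N ∩ interior K) (N ∩ interior K) := by
  obtain ⟨δ, hδ, hball⟩ := Metric.isOpen_iff.1 isOpen_interior x hx
  have hδ2 : 0 < δ / 2 := by positivity
  -- An open square of half-side δ/2, which fits in the ball of radius δ. Its graph is constant, so
  -- box and rectangle coincide and the link is already from V to itself.
  set V := graphBox x (LinearIsometryEquiv.refl ℝ Plane) (δ / 2) (fun _ => -(δ / 2)) (δ / 2)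
    with hV
  have hVo : IsOpen V := isOpen_graphBox _ _ _ continuous_const _
  have hVsub : V ⊆ interior K := by
    intro p hp
    apply hball
    obtain ⟨h0, h1, h2⟩ := hp
    change |(p - x) 0| < δ / 2 at h0
    change _ < (p - x) 1 at h1
    change (p - x) 1 < _ at h2
    have h1' : |(p - x) 1| < δ / 2 := abs_lt.2 ⟨h1, h2⟩
    rw [mem_ball_iff_norm]
    refine lt_of_pow_lt_pow_left₀ 2 hδ.le ?_
    rw [EuclideanSpace.norm_sq_eq, Fin.sum_univ_two, Real.norm_eq_abs, Real.norm_eq_abs]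
    nlinarith [abs_nonneg ((p - x) 0), abs_nonneg ((p - x) 1)]
  refine ⟨V, hVo.mem_nhds ?_, ?_⟩
  · simp [hV, graphBox, hδ]
  · exact (linked_graphBox hK x _ continuous_const (fun _ _ => le_rfl) hVsub).mono
      inter_subset_left inter_subset_left

lemma HasLipschitzBoundary.exists_graphBox {K : Set Plane} (hK : HasLipschitzBoundary K)
    {x : Plane} (hx : x ∈ frontier K) :
    ∃ (e : Plane ≃ₗᵢ[ℝ] Plane) (φ : ℝ → ℝ) (a b c : ℝ), Continuous φ ∧ 0 < a ∧ 0 < c ∧ c < b ∧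
      φ 0 = 0 ∧ (∀ s, |s| < a → φ s ≤ c) ∧ graphBox x e a φ b ⊆ interior K ∧
      ∃ N ∈ 𝓝 x, N ∩ interior K ⊆ graphBox x e a φ b := by
  obtain ⟨e, L, φ, r, hr, hφ, h⟩ := hK x hx
  -- The point y = 0 corresponds to x, a boundary point, hence it lies on the graph.
  have hφ0 : φ 0 = 0 := by
    simpa [hr, hx, eq_comm] using (h 0 (by simpa using hr) (by simpa using hr)).2
  have hc : ∀ᶠ s in 𝓝 (0 : ℝ), |φ s| < r / 4 := by
    have : Tendsto (fun s => |φ s|) (𝓝 0) (𝓝 |φ 0|) := hφ.continuous.abs.tendsto 0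
    rw [hφ0, abs_zero] at this
    exact this.eventually (gt_mem_nhds (by positivity))
  obtain ⟨a', ha', hφa'⟩ := Metric.eventually_nhds_iff.1 hc
  have hφa : ∀ s, |s| < min a' r → |φ s| < r / 4 := fun s hs =>
    hφa' (by simpa using hs.trans_le (min_le_left _ _))
  have hloc : ∀ p : Plane, |e.symm (p - x) 0| < min a' r → |e.symm (p - x) 1| < r →
      (p ∈ interior K ↔ φ (e.symm (p - x) 0) < e.symm (p - x) 1) := fun p h0 h1 => by
    simpa using (h (e.symm (p - x)) (h0.trans_le (min_le_right _ _)) h1).1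
  have hcont : ∀ i, Continuous fun p : Plane => |e.symm (p - x) i| := fun i => by fun_prop
  -- With |φ| < r/4 on the base, a box of height r/2 stays inside the window |y 1| < r where the
  -- graph describes K.
  refine ⟨e, φ, min a' r, r / 2, r / 4, hφ.continuous, lt_min ha' hr, by positivity, by linarith,
    hφ0, fun s hs => (le_abs_self _).trans (hφa s hs).le, fun p hp => ?_,
    {p | |e.symm (p - x) 0| < min a' r ∧ |e.symm (p - x) 1| < r / 2}, ?_, ?_⟩
  · obtain ⟨h0, h1, h2⟩ := hp
    have := (abs_lt.1 (hφa _ h0)).1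
    exact (hloc p h0 (abs_lt.2 ⟨by linarith, by linarith⟩)).2 h1
  · exact ((isOpen_lt (hcont 0) continuous_const).inter
      (isOpen_lt (hcont 1) continuous_const)).mem_nhds (by simp [ha', hr])
  · rintro p ⟨⟨h0, h1⟩, hp⟩
    exact ⟨h0, (hloc p h0 (h1.trans (by linarith))).1 hp, (abs_lt.1 h1).2⟩

/-- Moving a boundary point slightly upwards in its graph coordinates leads into the interior. This
guarantees that every neighbourhood of a point of the closure meets the interior in positive
measure. -/
lemma HasLipschitzBoundary.closure_subset {K : Set Plane} (hK : HasLipschitzBoundary K) :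
    closure K ⊆ closure (interior K) := by
  intro x hx
  by_cases hxi : x ∈ interior K
  · exact subset_closure hxi
  obtain ⟨e, φ, a, b, c, hφ, ha, hc, hcb, hφ0, -, hV, -⟩ := hK.exists_graphBox ⟨hx, hxi⟩
  rw [Metric.mem_closure_iff]
  intro ε hε
  have hm : 0 < min (ε / 2) c := lt_min (by positivity) hc
  refine ⟨x + e (EuclideanSpace.single 1 (min (ε / 2) c)), hV ?_, ?_⟩
  · simp [graphBox, hφ0, ha, hε, hc, hcb]
  · rw [dist_eq_norm, sub_add_cancel_left, norm_neg, e.norm_map, PiLp.norm_single,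
      Real.norm_eq_abs, abs_of_pos hm]
    exact (min_le_left _ _).trans_lt (by linarith)

lemma Linked.exists_nhds {K : Set Plane} (hK : HasLipschitzBoundary K)
    (hb : Bornology.IsBounded (interior K)) {x : Plane} (hx : x ∈ closure K) :
    ∃ N ∈ 𝓝 x, Linked (interior K) (N ∩ interior K) (N ∩ interior K) := by
  by_cases hxi : x ∈ interior K
  · exact exists_nhds_of_mem_interior hb hxi
  obtain ⟨e, φ, a, b, c, hφ, ha, hc, hcb, hφ0, hφc, hV, N, hN, hNV⟩ :=
    hK.exists_graphBox ⟨hx, hxi⟩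
  have hl := linked_graphBox hb x e hφ hφc hV
  have hsub : graphBox x e a (fun _ => c) b ⊆ graphBox x e a φ b :=
    fun p hp => ⟨hp.1, (hφc _ hp.1).trans_lt hp.2.1, hp.2.2⟩
  have hVfin : volume (graphBox x e a φ b) ≠ ⊤ := (hb.subset hV).measure_lt_top.ne
  have hR0 : volume (graphBox x e a (fun _ => c) b) ≠ 0 := by
    refine ((isOpen_graphBox x e a continuous_const b).measure_pos volume ?_).ne'
    refine ⟨x + e (EuclideanSpace.single 1 ((b + c) / 2)), ?_⟩
    simp only [graphBox, mem_ofPred_eq, add_sub_cancel_left, e.symm_apply_apply,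
      PiLp.single_apply]
    norm_num
    exact ⟨ha, by linarith, by linarith⟩
  -- The box is linked to itself by going to the rectangle and back.
  exact ⟨N, hN, (hl.trans hl.symm hVfin (measure_ne_top_of_subset hsub hVfin) hR0 hVfin).mono
    hNV hNV⟩

/-! ### Global link by connectedness and compactness -/

/-- A Poincaré inequality on bounded connected Lipschitz domains, in a form in which the function
enters only through its increments. -/
theorem linked_interior {K : Set Plane} (hK : HasLipschitzBoundary K) (hconn : IsConnected K)
    (hc : IsCompact (closure K)) : Linked (interior K) (interior K) (interior K) := by
  have hb : Bornology.IsBounded (interior K) :=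
    hc.isBounded.subset (interior_subset.trans subset_closure)
  have hfin : ∀ S, volume (S ∩ interior K) ≠ ⊤ := fun S =>
    (hb.subset inter_subset_right).measure_lt_top.ne
  have hpos : ∀ x ∈ closure K, ∀ N ∈ 𝓝 x, volume (N ∩ interior K) ≠ 0 := by
    intro x hx N hN
    have h1 : (interior N ∩ interior K).Nonempty :=
      mem_closure_iff_nhds.1 (hK.closure_subset hx) _ (interior_mem_nhds.2 hN)
    have h2 := (isOpen_interior.inter isOpen_interior).measure_pos volume h1
    exact (h2.trans_le (measure_mono (inter_subset_inter_left _ interior_subset))).ne'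
  have hpath : ∀ x ∈ closure K, ∀ y ∈ closure K,
      ∃ M ∈ 𝓝 x, ∃ N ∈ 𝓝 y, Linked (interior K) (M ∩ interior K) (N ∩ interior K) := by
    intro x hx y hy
    -- Having linked neighbourhoods is a symmetric, transitive relation that holds between nearby
    -- points, so it holds throughout the connected closure. Working in the closure avoids any claim
    -- about connectedness of the interior.
    refine hconn.closure.isPreconnected.induction₂ (fun x y =>
      ∃ M ∈ 𝓝 x, ∃ N ∈ 𝓝 y, Linked (interior K) (M ∩ interior K) (N ∩ interior K))
      ?_ ?_ ?_ hx hy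
    · intro x hx
      obtain ⟨N, hN, hl⟩ := Linked.exists_nhds hK hb hx
      filter_upwards [nhdsWithin_le_nhds (eventually_mem_nhds_iff.2 hN)] with y hy
      exact ⟨N, hN, N, hy, hl⟩
    · rintro x y z - hy - ⟨M, hM, N, hN, h1⟩ ⟨N', hN', P, hP, h2⟩
      refine ⟨M, hM, P, hP, ?_⟩
      have h1' := h1.mono (B' := (N ∩ N') ∩ interior K) subset_rfl
        (inter_subset_inter_left _ inter_subset_left)
      have h2' := h2.mono (A' := (N ∩ N') ∩ interior K)
        (inter_subset_inter_left _ inter_subset_right) subset_rfl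
      exact h1'.trans h2' (hfin _) (hfin _) (hpos y hy _ (inter_mem hN hN')) (hfin _)
    · rintro x y - - ⟨M, hM, N, hN, h⟩
      exact ⟨N, hN, M, hM, h.symm⟩
  obtain ⟨y, hy⟩ := hconn.nonempty
  have hy := subset_closure hy
  have hcov : ∃ N ∈ 𝓝 y, Linked (interior K) (closure K ∩ interior K) (N ∩ interior K) := by
    -- Finitely many neighbourhoods cover the closure; the neighbourhoods of the base point y are
    -- intersected along the way.
    refine hc.induction_on (p := fun S => ∃ N ∈ 𝓝 y,
      Linked (interior K) (S ∩ interior K) (N ∩ interior K)) ?_ ?_ ?_ ?_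
    · exact ⟨univ, univ_mem, 0, fun U E _ _ => by simp⟩
    · rintro S T hST ⟨N, hN, h⟩
      exact ⟨N, hN, h.mono (inter_subset_inter_left _ hST) subset_rfl⟩
    · rintro S T ⟨N, hN, h⟩ ⟨N', hN', h'⟩
      refine ⟨N ∩ N', inter_mem hN hN', ?_⟩
      rw [union_inter_distrib_right]
      exact (h.mono subset_rfl (inter_subset_inter_left _ inter_subset_left)).union
        (h'.mono subset_rfl (inter_subset_inter_left _ inter_subset_right))
    · intro x hx
      obtain ⟨M, hM, N, hN, h⟩ := hpath x hx y hy
      exact ⟨M, nhdsWithin_le_nhds hM, N, hN, h⟩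
  obtain ⟨N, hN, h⟩ := hcov
  rw [inter_eq_right.2 (interior_subset.trans subset_closure)] at h
  have hf := hb.measure_lt_top (μ := volume).ne
  exact h.trans h.symm hf (hfin _) (hpos y hy N hN) hf

/-! ### Sobolev functions along segments -/

section Translation

variable {G u : Plane → ℝ} {h : Plane}

lemma integrable_comp_add_smul (hG : Integrable G) (h : Plane) :
    Integrable (fun z : ℝ × Plane => G (z.2 + z.1 • h))
      ((volume.restrict (Ioc (0 : ℝ) 1)).prod volume) := by
  -- The shear (t, x) ↦ (t, x + t h) preserves the product measure.
  have hmp : MeasurePreserving (fun z : ℝ × Plane => (z.1, z.2 + z.1 • h))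
      ((volume.restrict (Ioc (0 : ℝ) 1)).prod volume)
      ((volume.restrict (Ioc (0 : ℝ) 1)).prod volume) := by
    refine (MeasurePreserving.id _).skew_product (g := fun t x => x + t • h)
      (Measurable.add measurable_snd (measurable_fst.smul_const h)) ?_
    exact Eventually.of_forall fun t => (measurePreserving_add_right volume (t • h)).map_eq
  exact hmp.integrable_comp_of_integrable (hG.comp_snd _)

lemma ContDiff.integral_fderiv_sub_smul {ψ : Plane → ℝ} (hψ : ContDiff ℝ ∞ ψ) (h x : Plane) :
    ∫ t in Ioc (0 : ℝ) 1, fderiv ℝ ψ (x - t • h) h = ψ x - ψ (x - h) := by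
  have hderiv : ∀ t : ℝ, HasDerivAt (fun t : ℝ => -ψ (x - t • h)) (fderiv ℝ ψ (x - t • h) h) t := by
    intro t
    have h1 : HasDerivAt (fun t : ℝ => x - t • h) (-h) t := by
      simpa using ((hasDerivAt_id t).smul_const h).const_sub x
    have h2 := ((hψ.differentiable (by simp)) (x - t • h)).hasFDerivAt.comp_hasDerivAt t h1
    simpa [Function.comp_def] using h2.fun_neg
  have hcont : Continuous fun t : ℝ => fderiv ℝ ψ (x - t • h) h :=
    ((hψ.continuous_fderiv (by simp)).comp (by fun_prop)).clm_apply continuous_const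
  rw [← intervalIntegral.integral_of_le zero_le_one,
    intervalIntegral.integral_eq_sub_of_hasDerivAt (fun t _ => hderiv t)
      (hcont.intervalIntegrable _ _)]
  simp [sub_eq_add_neg, add_comm]

/-- A function with a weak directional derivative `G` on `Ω` is the integral of `G` along almost
every segment in `Ω` of that direction. -/
theorem ae_sub_eq_integral_of_weak_deriv {Ω A : Set Plane} (hu : Integrable u) (hG : Integrable G)
    (hw : ∀ ψ : Plane → ℝ, ContDiff ℝ ∞ ψ → HasCompactSupport ψ → tsupport ψ ⊆ Ω →
      ∫ x, u x * fderiv ℝ ψ x h = -∫ x, G x * ψ x)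
    (hA : IsOpen A) (hAΩ : ∀ x ∈ A, ∀ t ∈ Icc (0 : ℝ) 1, x + t • h ∈ Ω) :
    ∀ᵐ x, x ∈ A → u (x + h) - u x = ∫ t in Ioc (0 : ℝ) 1, G (x + t • h) := by
  have hprod := integrable_comp_add_smul hG h
  have hint : Integrable fun x => ∫ t in Ioc (0 : ℝ) 1, G (x + t • h) := hprod.integral_prod_right
  have huh : Integrable fun x => u (x + h) := hu.comp_add_right h
  have hf : Integrable fun x => u (x + h) - u x - ∫ t in Ioc (0 : ℝ) 1, G (x + t • h) :=
    (huh.sub hu).sub hint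
  suffices hz : ∀ᵐ x, x ∈ A → u (x + h) - u x - ∫ t in Ioc (0 : ℝ) 1, G (x + t • h) = 0 by
    filter_upwards [hz] with x hx hxA using sub_eq_zero.1 (hx hxA)
  -- By the fundamental lemma it suffices to test with ψ supported in A. Fubini moves the
  -- translation from G to ψ, the weak derivative moves onto the translated ψ, and integrating over
  -- t leaves ψ(x) − ψ(x − h).
  refine hA.ae_eq_zero_of_integral_contDiff_smul_eq_zero (hf.locallyIntegrable.locallyIntegrableOn A)
    fun ψ hψ hψc hψA => ?_
  obtain ⟨M, hM⟩ := hψ.continuous.bounded_above_of_compact_support hψc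
  have hdψ : Continuous (fun x => fderiv ℝ ψ x h) :=
    (hψ.continuous_fderiv (by simp)).clm_apply continuous_const
  obtain ⟨M', hM'⟩ := hdψ.bounded_above_of_compact_support (hψc.fderiv_apply ℝ h)
  have hmul : ∀ {f : Plane → ℝ}, Integrable f → Integrable fun x => ψ x * f x := fun hf =>
    hf.bdd_mul hψ.continuous.aestronglyMeasurable (ae_of_all _ hM)
  -- the translates of the test function are test functions on `Ω`
  have htrans : ∀ t ∈ Icc (0 : ℝ) 1, ∫ x, ψ x * G (x + t • h) =
      -∫ x, u x * fderiv ℝ ψ (x - t • h) h := by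
    intro t ht
    have hc : HasCompactSupport fun x => ψ (x - t • h) :=
      hψc.comp_homeomorph (Homeomorph.subRight (t • h))
    have hs : tsupport (fun x => ψ (x - t • h)) ⊆ Ω := by
      intro x hx
      have h1 : x - t • h ∈ tsupport ψ := by
        rw [show (fun x => ψ (x - t • h)) = ψ ∘ Homeomorph.subRight (t • h) from rfl,
          tsupport_comp_eq_preimage] at hx
        exact hx
      simpa using hAΩ _ (hψA h1) t ht
    have hd : ContDiff ℝ ∞ fun x => ψ (x - t • h) := hψ.comp (contDiff_id.sub contDiff_const)
    have h2 := hw _ hd hc hs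
    have h3 : ∀ x, fderiv ℝ (fun y => ψ (y - t • h)) x = fderiv ℝ ψ (x - t • h) := fun x => by
      simp only [sub_eq_add_neg, fderiv_comp_add_right]
    simp only [h3] at h2
    rw [h2, neg_neg, ← integral_sub_right_eq_self _ (t • h)]
    simp [mul_comm]
  have h1 : ∫ x, ψ x * u (x + h) = ∫ x, u x * ψ (x - h) := by
    rw [← integral_sub_right_eq_self _ h]
    simp [mul_comm]
  have h2 : ∫ x, ψ x * ∫ t in Ioc (0 : ℝ) 1, G (x + t • h) =
      -∫ x, u x * (ψ x - ψ (x - h)) := by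
    calc ∫ x, ψ x * ∫ t in Ioc (0 : ℝ) 1, G (x + t • h)
        = ∫ x, ∫ t in Ioc (0 : ℝ) 1, ψ x * G (x + t • h) := by
          simp_rw [integral_const_mul]
      _ = ∫ t in Ioc (0 : ℝ) 1, ∫ x, ψ x * G (x + t • h) := by
          refine (integral_integral_swap ?_).symm
          exact hprod.bdd_mul (hψ.continuous.comp continuous_snd).aestronglyMeasurable
            (ae_of_all _ fun z => hM z.2)
      _ = ∫ t in Ioc (0 : ℝ) 1, -∫ x, u x * fderiv ℝ ψ (x - t • h) h :=
          setIntegral_congr_fun measurableSet_Ioc fun t ht => htrans t (Ioc_subset_Icc_self ht)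
      _ = -∫ x, ∫ t in Ioc (0 : ℝ) 1, u x * fderiv ℝ ψ (x - t • h) h := by
          rw [integral_neg, integral_integral_swap]
          refine (hu.comp_snd _).mul_bdd (c := M') ?_ (ae_of_all _ fun z => hM' _)
          exact (hdψ.comp (by fun_prop : Continuous fun z : ℝ × Plane =>
            z.2 - z.1 • h)).aestronglyMeasurable
      _ = -∫ x, u x * (ψ x - ψ (x - h)) := by
          simp_rw [integral_const_mul, ContDiff.integral_fderiv_sub_smul hψ]
  have i1 : Integrable fun x => u x * ψ (x - h) :=
    hu.mul_bdd (hψ.continuous.comp (by fun_prop)).aestronglyMeasurable (ae_of_all _ fun x => hM _)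
  have i2 : Integrable fun x => u x * ψ x :=
    hu.mul_bdd hψ.continuous.aestronglyMeasurable (ae_of_all _ hM)
  simp only [smul_eq_mul, mul_sub]
  rw [integral_sub (f := fun x => ψ x * u (x + h) - ψ x * u x) ((hmul huh).sub (hmul hu))
    (hmul hint), integral_sub (hmul huh) (hmul hu), h1, h2]
  simp only [mul_sub]
  rw [integral_sub i2 i1]
  simp [mul_comm]

lemma sq_lintegral_le_lintegral_sq {α : Type*} [MeasurableSpace α] {ν : Measure α}
    [IsProbabilityMeasure ν] {f : α → ℝ} (hf : AEStronglyMeasurable f ν) :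
    (∫⁻ t, ‖f t‖ₑ ∂ν) ^ 2 ≤ ∫⁻ t, ‖f t‖ₑ ^ 2 ∂ν := by
  have h1 := eLpNorm_le_eLpNorm_of_exponent_le (p := 1) (q := 2) (by norm_num) hf
  have h2 := eLpNorm_nnreal_pow_eq_lintegral (f := f) (μ := ν) (p := 2) (by norm_num)
  rw [eLpNorm_one_eq_lintegral_enorm] at h1
  norm_num at h2
  rw [← h2]
  gcongr

lemma lintegral_sq_integral_segment_le (hG : Integrable G) (A : Set Plane) (h : Plane) :
    ∫⁻ x in A, ‖∫ t in Ioc (0 : ℝ) 1, G (x + t • h)‖ₑ ^ 2 ≤ ∫⁻ x, ‖G x‖ₑ ^ 2 := by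
  have hprod := (integrable_comp_add_smul hG h).aestronglyMeasurable
  have : IsProbabilityMeasure (volume.restrict (Ioc (0 : ℝ) 1)) := ⟨by simp⟩
  calc ∫⁻ x in A, ‖∫ t in Ioc (0 : ℝ) 1, G (x + t • h)‖ₑ ^ 2
      ≤ ∫⁻ x, ‖∫ t in Ioc (0 : ℝ) 1, G (x + t • h)‖ₑ ^ 2 := setLIntegral_le_lintegral _ _
    _ ≤ ∫⁻ x, ∫⁻ t in Ioc (0 : ℝ) 1, ‖G (x + t • h)‖ₑ ^ 2 := by
        refine lintegral_mono_ae ?_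
        filter_upwards [hprod.prodMk_right] with x hx
        exact (pow_le_pow_left' (enorm_integral_le_lintegral_enorm _) 2).trans
          (sq_lintegral_le_lintegral_sq hx)
    _ = ∫⁻ t in Ioc (0 : ℝ) 1, ∫⁻ x, ‖G (x + t • h)‖ₑ ^ 2 :=
        (lintegral_lintegral_swap (hprod.enorm.pow_const 2)).symm
    _ = ∫⁻ t in Ioc (0 : ℝ) 1, ∫⁻ x, ‖G x‖ₑ ^ 2 := by
        refine lintegral_congr fun t => ?_
        exact lintegral_add_right_eq_self (fun x => ‖G x‖ₑ ^ 2) (t • h)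
    _ = ∫⁻ x, ‖G x‖ₑ ^ 2 := by simp

end Translation

/-! ### Calculus of weak derivatives -/

section WeakDeriv

variable {Ω : Opens Plane} {α β : ℕ × ℕ} {f f' g g' : Plane → ℝ}

/-- The multi-index of the partial derivative in the `i`-th coordinate. -/
def coordIdx : Fin 2 → ℕ × ℕ := ![(1, 0), (0, 1)]

lemma lineDerivOp_apply (φ : 𝓓(Ω, ℝ)) (v x : Plane) : (∂_{v} φ) x = fderiv ℝ φ x v := by
  change (TestFunction.lineDerivCLM ℝ v φ : 𝓓(Ω, ℝ)) x = _
  rw [TestFunction.lineDerivCLM_eq_fderivCLM, TestFunction.fderivCLM_apply_of_le _ (by simp)]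

lemma testDeriv_coordIdx (i : Fin 2) (φ : 𝓓(Ω, ℝ)) :
    testDeriv (coordIdx i) φ = ∂_{unitVec i} φ := by
  fin_cases i <;> rfl

lemma testDeriv_coordIdx_apply (i : Fin 2) (φ : 𝓓(Ω, ℝ)) (x : Plane) :
    testDeriv (coordIdx i) φ x = fderiv ℝ φ x (unitVec i) := by
  rw [testDeriv_coordIdx, lineDerivOp_apply]

lemma testDeriv_zero (φ : 𝓓(Ω, ℝ)) : testDeriv 0 φ = φ := rfl

lemma lineDerivOp_comm (φ : 𝓓(Ω, ℝ)) (v w : Plane) : ∂_{v} (∂_{w} φ) = ∂_{w} (∂_{v} φ) := by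
  ext x
  have hd : DifferentiableAt ℝ (fderiv ℝ φ) x :=
    ((φ.contDiff.fderiv_right (m := 1) (by norm_cast)).differentiable (by simp)) x
  have h : ∀ v w : Plane, (∂_{v} (∂_{w} φ)) x = fderiv ℝ (fderiv ℝ φ) x v w := fun v w => by
    rw [lineDerivOp_apply, show ((∂_{w} φ : 𝓓(Ω, ℝ)) : Plane → ℝ) = fun y => fderiv ℝ φ y w from
      funext fun y => lineDerivOp_apply φ w y, fderiv_clm_apply hd (by fun_prop)]
    simp
  rw [h, h]
  exact (φ.contDiff.contDiffAt.isSymmSndFDerivAt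
    (by rw [minSmoothness_of_isRCLikeNormedField]; norm_cast)) v w

lemma testDeriv_add (α β : ℕ × ℕ) (φ : 𝓓(Ω, ℝ)) :
    testDeriv (α + β) φ = testDeriv α (testDeriv β φ) := by
  have hc : Function.Commute (fun ψ : 𝓓(Ω, ℝ) => ∂_{unitVec 0} ψ)
      (fun ψ : 𝓓(Ω, ℝ) => ∂_{unitVec 1} ψ) := fun ψ => lineDerivOp_comm ψ _ _
  simp only [testDeriv, Prod.fst_add, Prod.snd_add, Function.iterate_add_apply]
  congr 1
  exact (hc.iterate_iterate β.1 α.2).eq _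

lemma integrable_mul_testFunction (hf : LocallyIntegrableOn f Ω) (φ : 𝓓(Ω, ℝ)) :
    Integrable (fun x => f x * φ x) (volume.restrict Ω) := by
  have := (φ.integrable_bilin (ContinuousLinearMap.mul ℝ ℝ) hf).restrict (s := (Ω : Set Plane))
  simpa [mul_comm] using this

/-- A smooth compactly supported function as a test function. -/
def mkTest {ψ : Plane → ℝ} (h1 : ContDiff ℝ ∞ ψ) (h2 : HasCompactSupport ψ)
    (h3 : tsupport ψ ⊆ Ω) : 𝓓(Ω, ℝ) := ⟨ψ, h1, h2, h3⟩

lemma coe_mkTest {ψ : Plane → ℝ} (h1 : ContDiff ℝ ∞ ψ) (h2 : HasCompactSupport ψ)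
    (h3 : tsupport ψ ⊆ Ω) : (mkTest h1 h2 h3 : Plane → ℝ) = ψ := rfl

lemma testFunction_eq_zero (φ : 𝓓(Ω, ℝ)) {x : Plane} (hx : x ∉ Ω) : φ x = 0 :=
  image_eq_zero_of_notMem_tsupport fun h => hx (φ.tsupport_subset h)

lemma setIntegral_mul_testFunction (f : Plane → ℝ) (φ : 𝓓(Ω, ℝ)) :
    ∫ x in Ω, f x * φ x = ∫ x, f x * φ x :=
  setIntegral_eq_integral_of_forall_compl_eq_zero fun x hx => by
    rw [testFunction_eq_zero φ hx, mul_zero]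

lemma ae_eq_of_integral_testFunction (hf : LocallyIntegrableOn f Ω) (hg : LocallyIntegrableOn g Ω)
    (h : ∀ φ : 𝓓(Ω, ℝ), ∫ x in Ω, f x * φ x = ∫ x in Ω, g x * φ x) :
    f =ᵐ[volume.restrict Ω] g := by
  have hz := Ω.isOpen.ae_eq_zero_of_integral_contDiff_smul_eq_zero (hf.sub hg) (μ := volume)
    fun ψ h1 h2 h3 => by
      have h4 := h (mkTest h1 h2 h3)
      have i1 := integrable_mul_testFunction hf (mkTest h1 h2 h3)
      have i2 := integrable_mul_testFunction hg (mkTest h1 h2 h3)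
      have h5 := setIntegral_mul_testFunction (f - g) (mkTest h1 h2 h3)
      simp only [Pi.sub_apply, sub_mul] at h5
      rw [integral_sub i1 i2, h4, sub_self] at h5
      rw [h5]
      simp [coe_mkTest, mul_comm, mul_sub]
  rw [EventuallyEq, ae_restrict_iff' Ω.isOpen.measurableSet]
  filter_upwards [hz] with x hx hxΩ using sub_eq_zero.1 (hx hxΩ)

namespace HasWeakDeriv

lemma unique (h : HasWeakDeriv Ω α f g) (h' : HasWeakDeriv Ω α f g') :
    g =ᵐ[volume.restrict Ω] g' := by
  refine ae_eq_of_integral_testFunction h.2.1 h'.2.1 fun φ => ?_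
  have := (h.2.2 φ).symm.trans (h'.2.2 φ)
  exact mul_left_cancel₀ (pow_ne_zero _ (by norm_num)) this

lemma zero (hf : LocallyIntegrableOn f Ω) : HasWeakDeriv Ω 0 f f :=
  ⟨hf, hf, fun φ => by simp [testDeriv_zero]⟩

lemma sub (h : HasWeakDeriv Ω α f g) (h' : HasWeakDeriv Ω α f' g') :
    HasWeakDeriv Ω α (fun x => f x - f' x) (fun x => g x - g' x) := by
  refine ⟨h.1.sub h'.1, h.2.1.sub h'.2.1, fun φ => ?_⟩
  simp only [sub_mul]
  rw [integral_sub (integrable_mul_testFunction h.1 _) (integrable_mul_testFunction h'.1 _),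
    integral_sub (integrable_mul_testFunction h.2.1 _) (integrable_mul_testFunction h'.2.1 _),
    h.2.2, h'.2.2, mul_sub]

lemma trans (h : HasWeakDeriv Ω α f g) (h' : HasWeakDeriv Ω β g g') :
    HasWeakDeriv Ω (α + β) f g' := by
  refine ⟨h.1, h'.2.1, fun φ => ?_⟩
  rw [testDeriv_add, h.2.2, h'.2.2, ← mul_assoc, ← pow_add]
  simp only [Prod.fst_add, Prod.snd_add]
  congr 2
  ring

/-- Membership in H^k supplies each derivative of f separately; this recovers the relation between
two of them, so that the Poincaré inequality can be applied to a derivative of f. -/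
lemma of_add (h : HasWeakDeriv Ω α f g) (h' : HasWeakDeriv Ω (α + β) f g') :
    HasWeakDeriv Ω β g g' := by
  refine ⟨h.2.1, h'.2.1, fun φ => ?_⟩
  have h1 := h.2.2 (testDeriv β φ)
  rw [← testDeriv_add, h'.2.2] at h1
  refine mul_left_cancel₀ (pow_ne_zero (α.1 + α.2) (by norm_num : (-1 : ℝ) ≠ 0)) (h1.symm.trans ?_)
  rw [← mul_assoc, ← pow_add]
  simp only [Prod.fst_add, Prod.snd_add]
  congr 2
  ring

end HasWeakDeriv

lemma ContDiff.hasWeakDeriv (hf : ContDiff ℝ ∞ f) (i : Fin 2) :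
    HasWeakDeriv Ω (coordIdx i) f fun x => fderiv ℝ f x (unitVec i) := by
  have hc : Continuous fun x => fderiv ℝ f x (unitVec i) :=
    (hf.continuous_fderiv (by simp)).clm_apply continuous_const
  refine ⟨hf.continuous.locallyIntegrable.locallyIntegrableOn _,
    hc.locallyIntegrable.locallyIntegrableOn _, fun φ => ?_⟩
  have hi : ∀ {k : Plane → ℝ}, Continuous k → ∀ ψ : 𝓓(Ω, ℝ), Integrable fun x => k x * ψ x :=
    fun hk ψ => (hk.mul ψ.continuous).integrable_of_hasCompactSupport ψ.hasCompactSupport.mul_left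
  have h1 := hi hf.continuous (testDeriv (coordIdx i) φ)
  rw [setIntegral_mul_testFunction, setIntegral_mul_testFunction]
  simp only [testDeriv_coordIdx_apply] at h1 ⊢
  rw [integral_mul_fderiv_eq_neg_fderiv_mul_of_integrable (hi hc φ) h1 (hi hf.continuous φ)
    (fun x _ => hf.differentiable (by simp) x)
    (fun x _ => φ.contDiff.differentiable (by simp) x)]
  fin_cases i <;> simp [coordIdx]

end WeakDeriv

/-! ### Increments bounded by the Dirichlet integral, and dilations -/

section Scaling

variable {Ω : Opens Plane} {u U g₀ g₁ : Plane → ℝ}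

lemma lintegral_comp_affine (f : Plane → ℝ≥0∞) (z : Plane) {s : ℝ} (hs : 0 < s) :
    ∫⁻ x, f (z + s • x) = ENNReal.ofReal ((s ^ 2)⁻¹) * ∫⁻ x, f x := by
  have hemb : MeasurableEmbedding fun x : Plane => s • x :=
    (Homeomorph.smulOfNeZero s hs.ne').measurableEmbedding
  rw [← hemb.lintegral_map (fun y => f (z + y)), Measure.map_addHaar_smul volume hs.ne',
    lintegral_smul_measure, lintegral_add_left_eq_self f z, finrank_euclideanSpace_fin,
    abs_of_pos (by positivity)]
  rfl

lemma indicator_integrable (hu : IntegrableOn u Ω) : Integrable ((Ω : Set Plane).indicator u) :=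
  hu.integrable_indicator Ω.isOpen.measurableSet

lemma enorm_sq_add_mul_le (a b c d : ℝ) :
    ‖a * c + b * d‖ₑ ^ 2 ≤ ENNReal.ofReal (a ^ 2 + b ^ 2) * (‖c‖ₑ ^ 2 + ‖d‖ₑ ^ 2) := by
  simp only [enorm_sq_eq_ofReal]
  rw [← ENNReal.ofReal_add (by positivity) (by positivity), ← ENNReal.ofReal_mul (by positivity)]
  exact ENNReal.ofReal_le_ofReal (by nlinarith [sq_nonneg (a * d - b * c)])

lemma fderiv_apply_eq (ψ : Plane → ℝ) (x h : Plane) :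
    fderiv ℝ ψ x h = h 0 * fderiv ℝ ψ x (unitVec 0) + h 1 * fderiv ℝ ψ x (unitVec 1) := by
  have : h = h 0 • unitVec 0 + h 1 • unitVec 1 := by
    ext i
    fin_cases i <;> simp [unitVec]
  conv_lhs => rw [this]
  simp

lemma enorm_sq_eq_coords (h : Plane) : ‖h‖ₑ ^ 2 = ENNReal.ofReal (h 0 ^ 2 + h 1 ^ 2) := by
  rw [← ofReal_norm, ← ENNReal.ofReal_pow (norm_nonneg _), EuclideanSpace.norm_sq_eq,
    Fin.sum_univ_two]
  simp

/-- Increments of a function with weak gradient `(g₀, g₁)`. -/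
theorem translationBound_of_hasWeakDeriv (hu : IntegrableOn u Ω) (hg₀ : IntegrableOn g₀ Ω)
    (hg₁ : IntegrableOn g₁ Ω) (h₀ : HasWeakDeriv Ω (coordIdx 0) u g₀)
    (h₁ : HasWeakDeriv Ω (coordIdx 1) u g₁) (hU : u =ᵐ[volume.restrict Ω] U) :
    TranslationBound Ω U (∫⁻ x in Ω, (‖g₀ x‖ₑ ^ 2 + ‖g₁ x‖ₑ ^ 2)) := by
  intro A h hA hAΩ
  have hΩm := Ω.isOpen.measurableSet
  -- Extension by zero makes the directional derivative integrable on the whole plane; test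
  -- functions supported in Ω do not see the extension.
  set G : Plane → ℝ := (Ω : Set Plane).indicator fun x => h 0 * g₀ x + h 1 * g₁ x with hGdef
  have hG : Integrable G := indicator_integrable ((hg₀.const_mul _).add (hg₁.const_mul _))
  have hw : ∀ ψ : Plane → ℝ, ContDiff ℝ ∞ ψ → HasCompactSupport ψ → tsupport ψ ⊆ Ω →
      ∫ x, (Ω : Set Plane).indicator u x * fderiv ℝ ψ x h = -∫ x, G x * ψ x := by
    intro ψ k1 k2 k3
    have e : ∀ f k : Plane → ℝ, ∫ x, (Ω : Set Plane).indicator f x * k x = ∫ x in Ω, f x * k x :=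
      fun f k => by
        rw [← integral_indicator hΩm]
        refine integral_congr_ae (ae_of_all _ fun x => ?_)
        by_cases hx : x ∈ (Ω : Set Plane) <;> simp [hx]
    have a0 := h₀.2.2 (mkTest k1 k2 k3)
    have a1 := h₁.2.2 (mkTest k1 k2 k3)
    have i0 := integrable_mul_testFunction h₀.1 (testDeriv (coordIdx 0) (mkTest k1 k2 k3))
    have i1 := integrable_mul_testFunction h₁.1 (testDeriv (coordIdx 1) (mkTest k1 k2 k3))
    have j0 := integrable_mul_testFunction h₀.2.1 (mkTest k1 k2 k3)
    have j1 := integrable_mul_testFunction h₁.2.1 (mkTest k1 k2 k3)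
    simp only [testDeriv_coordIdx_apply, coe_mkTest] at a0 a1 i0 i1 j0 j1
    rw [hGdef, e, e]
    simp only [fderiv_apply_eq ψ _ h, mul_add, add_mul, mul_left_comm (u _), mul_assoc]
    rw [integral_add (i0.const_mul _) (i1.const_mul _), integral_add (j0.const_mul _)
      (j1.const_mul _), integral_const_mul, integral_const_mul, integral_const_mul,
      integral_const_mul, a0, a1]
    simp only [coordIdx]
    norm_num
    ring
  have hae := ae_sub_eq_integral_of_weak_deriv (indicator_integrable hu) hG hw hA hAΩ
  rw [EventuallyEq, ae_restrict_iff' hΩm] at hU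
  have hU' : ∀ᵐ x, x + h ∈ (Ω : Set Plane) → u (x + h) = U (x + h) :=
    (measurePreserving_add_right volume h).quasiMeasurePreserving.ae hU
  calc ∫⁻ x in A, ‖U (x + h) - U x‖ₑ ^ 2
      = ∫⁻ x in A, ‖∫ t in Ioc (0 : ℝ) 1, G (x + t • h)‖ₑ ^ 2 := by
        refine setLIntegral_congr_fun_ae hA.measurableSet ?_
        filter_upwards [hae, hU, hU'] with x k1 k2 k3 hx
        have m0 : x ∈ (Ω : Set Plane) := by simpa using hAΩ x hx 0 (by simp)
        have m1 : x + h ∈ (Ω : Set Plane) := by simpa using hAΩ x hx 1 (by simp)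
        rw [← k1 hx, indicator_of_mem m0, indicator_of_mem m1, k2 m0, k3 m1]
    _ ≤ ∫⁻ x, ‖G x‖ₑ ^ 2 := lintegral_sq_integral_segment_le hG A h
    _ = ∫⁻ x in Ω, ‖h 0 * g₀ x + h 1 * g₁ x‖ₑ ^ 2 := by
        rw [← lintegral_indicator hΩm]
        refine lintegral_congr fun x => ?_
        by_cases hx : x ∈ (Ω : Set Plane) <;> simp [hGdef, hx]
    _ ≤ ∫⁻ x in Ω, ‖h‖ₑ ^ 2 * (‖g₀ x‖ₑ ^ 2 + ‖g₁ x‖ₑ ^ 2) := by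
        refine lintegral_mono fun x => ?_
        rw [enorm_sq_eq_coords]
        exact enorm_sq_add_mul_le _ _ _ _
    _ = ‖h‖ₑ ^ 2 * ∫⁻ x in Ω, (‖g₀ x‖ₑ ^ 2 + ‖g₁ x‖ₑ ^ 2) :=
        lintegral_const_mul' _ _ (by simp)

/-- The same E works before and after: the Jacobian contributes s⁻² and the squared length of the
increment s². This cancellation is special to dimension two. -/
lemma TranslationBound.comp_affine {Ω Ω' : Set Plane} {E : ℝ≥0∞} (z : Plane) {s : ℝ} (hs : 0 < s)
    (h : TranslationBound Ω' U E) (hΩ : ∀ x ∈ Ω, z + s • x ∈ Ω') :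
    TranslationBound Ω (fun x => U (z + s • x)) E := by
  intro A v hA hAΩ
  have hinv : ∀ x : Plane, s⁻¹ • (z + s • x - z) = x := fun x => by
    rw [add_sub_cancel_left, inv_smul_smul₀ hs.ne']
  have hinv' : ∀ y : Plane, z + s • (s⁻¹ • (y - z)) = y := fun y => by
    rw [smul_inv_smul₀ hs.ne', add_sub_cancel]
  have hA' : IsOpen ((fun y => s⁻¹ • (y - z)) ⁻¹' A) := hA.preimage (by fun_prop)
  have h1 := h _ (s • v) hA' fun y hy t ht => by
    have := hΩ _ (hAΩ _ hy t ht)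
    rw [smul_add, ← add_assoc, hinv', smul_comm] at this
    exact this
  calc ∫⁻ x in A, ‖U (z + s • (x + v)) - U (z + s • x)‖ₑ ^ 2
      = ∫⁻ x, ((fun y => s⁻¹ • (y - z)) ⁻¹' A).indicator
          (fun y => ‖U (y + s • v) - U y‖ₑ ^ 2) (z + s • x) := by
        rw [← lintegral_indicator hA.measurableSet]
        refine lintegral_congr fun x => ?_
        by_cases hx : x ∈ A
        · rw [indicator_of_mem hx, indicator_of_mem (by rwa [mem_preimage, hinv]), smul_add,
            add_assoc]
        · rw [indicator_of_notMem hx, indicator_of_notMem (by rwa [mem_preimage, hinv])]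
    _ ≤ ENNReal.ofReal ((s ^ 2)⁻¹) * (‖s • v‖ₑ ^ 2 * E) := by
        rw [lintegral_comp_affine _ z hs, lintegral_indicator hA'.measurableSet]
        gcongr
    _ = ‖v‖ₑ ^ 2 * E := by
        rw [enorm_smul, mul_pow, enorm_sq_eq_ofReal, mul_assoc, ← mul_assoc,
          ← ENNReal.ofReal_mul (by positivity), inv_mul_cancel₀ (by positivity), ENNReal.ofReal_one,
          one_mul]

end Scaling

/-! ### Norms, seminorms and independence of representatives -/

section Norms

variable {Ω : Opens Plane} {f g g₀ g₁ u : Plane → ℝ} {α : ℕ × ℕ}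

lemma l2Norm_nonneg (Ω : Opens Plane) (f : Plane → ℝ) : 0 ≤ l2Norm Ω f := lpNorm_nonneg

lemma ofReal_l2Norm_sq (hf : MemL2 Ω f) :
    ENNReal.ofReal (l2Norm Ω f ^ 2) = ∫⁻ x in Ω, ‖f x‖ₑ ^ 2 := by
  rw [ENNReal.ofReal_pow (l2Norm_nonneg _ _), l2Norm, ofReal_lpNorm hf]
  have h2 := eLpNorm_nnreal_pow_eq_lintegral (f := f) (μ := volume.restrict (Ω : Set Plane)) (p := 2)
    (by norm_num)
  norm_num at h2
  exact h2

lemma l2Norm_congr (h : f =ᵐ[volume.restrict Ω] g) : l2Norm Ω f = l2Norm Ω g := by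
  -- `lpNorm` takes a default value on functions that are not a.e. strongly measurable, a property
  -- shared by a.e. equal functions.
  by_cases hf : AEStronglyMeasurable f (volume.restrict Ω)
  · rw [l2Norm, l2Norm, ← toReal_eLpNorm hf, ← toReal_eLpNorm (hf.congr h), eLpNorm_congr_ae h]
  · rw [l2Norm, l2Norm, lpNorm_of_not_aestronglyMeasurable hf,
      lpNorm_of_not_aestronglyMeasurable fun hg => hf (hg.congr h.symm)]

lemma weakDeriv_spec (h : HasWeakDeriv Ω α f g) (hg : MemL2 Ω g) :
    MemL2 Ω (weakDeriv Ω α f) ∧ HasWeakDeriv Ω α f (weakDeriv Ω α f) := by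
  have h' : ∃ g, MemL2 Ω g ∧ HasWeakDeriv Ω α f g := ⟨g, hg, h⟩
  rw [weakDeriv, dif_pos h']
  exact h'.choose_spec

lemma l2Norm_weakDeriv (h : HasWeakDeriv Ω α f g) (hg : MemL2 Ω g) :
    l2Norm Ω (weakDeriv Ω α f) = l2Norm Ω g :=
  l2Norm_congr ((weakDeriv_spec h hg).2.unique h)

lemma sobolevSeminorm_nonneg (k : ℕ) (Ω : Opens Plane) (f : Plane → ℝ) :
    0 ≤ sobolevSeminorm k Ω f := Real.sqrt_nonneg _

lemma sobolevSeminorm_sq {k : ℕ} {D : ℕ × ℕ → Plane → ℝ}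
    (h : ∀ α ∈ Finset.HasAntidiagonal.antidiagonal k, MemL2 Ω (D α) ∧ HasWeakDeriv Ω α f (D α)) :
    sobolevSeminorm k Ω f ^ 2 =
      ∑ α ∈ Finset.HasAntidiagonal.antidiagonal k, l2Norm Ω (D α) ^ 2 := by
  rw [sobolevSeminorm, Real.sq_sqrt (Finset.sum_nonneg fun _ _ => sq_nonneg _)]
  exact Finset.sum_congr rfl fun α hα => by rw [l2Norm_weakDeriv (h α hα).2 (h α hα).1]

lemma sobolevSeminorm_one_sq (h₀ : HasWeakDeriv Ω (coordIdx 0) f g₀) (hg₀ : MemL2 Ω g₀)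
    (h₁ : HasWeakDeriv Ω (coordIdx 1) f g₁) (hg₁ : MemL2 Ω g₁) :
    sobolevSeminorm 1 Ω f ^ 2 = l2Norm Ω g₀ ^ 2 + l2Norm Ω g₁ ^ 2 := by
  rw [sobolevSeminorm, Real.sq_sqrt (Finset.sum_nonneg fun _ _ => sq_nonneg _),
    Finset.Nat.sum_antidiagonal_succ, Finset.Nat.antidiagonal_zero, Finset.sum_singleton,
    l2Norm_weakDeriv (α := (0, 0 + 1)) h₁ hg₁, l2Norm_weakDeriv (α := (0 + 1, 0)) h₀ hg₀, add_comm]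

lemma MemL2.integrableOn (hΩ : Bornology.IsBounded (Ω : Set Plane)) (hf : MemL2 Ω f) :
    IntegrableOn f Ω := by
  have : IsFiniteMeasure (volume.restrict (Ω : Set Plane)) :=
    isFiniteMeasure_restrict.2 hΩ.measure_lt_top.ne
  exact hf.integrable (by norm_num)

end Norms

/-! ### The Poincaré inequality on rescaled domains -/

section Poincare

variable {K : Set Plane}

lemma mem_interior_rescale (z : Plane) {s : ℝ} (hs : 0 < s) {x : Plane} :
    z + s • x ∈ interior (rescale z s K) ↔ x ∈ interior K := by
  set F : Plane ≃ₜ Plane := (Homeomorph.smulOfNeZero s hs.ne').trans (Homeomorph.addLeft z)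
  have hF : rescale z s K = F '' K := rfl
  rw [hF, ← F.image_interior]
  exact F.injective.mem_set_image (a := x)

lemma lintegral_rescale {Ω : Opens Plane} (z : Plane) {s : ℝ} (hs : 0 < s)
    (hΩ : Ω = Opens.interior (rescale z s K)) (f : Plane → ℝ≥0∞) :
    ∫⁻ x in interior K, f (z + s • x) = ENNReal.ofReal ((s ^ 2)⁻¹) * ∫⁻ x in Ω, f x := by
  rw [← lintegral_indicator Ω.isOpen.measurableSet, ← lintegral_comp_affine _ z hs,
    ← lintegral_indicator isOpen_interior.measurableSet]
  refine lintegral_congr fun x => ?_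
  have h : z + s • x ∈ (Ω : Set Plane) ↔ x ∈ interior K := by
    rw [hΩ]; exact mem_interior_rescale z hs
  by_cases hx : x ∈ interior K
  · rw [indicator_of_mem hx, indicator_of_mem (h.2 hx)]
  · rw [indicator_of_notMem hx, indicator_of_notMem (fun h' => hx (h.1 h'))]

lemma isBounded_rescale (hc : IsCompact (closure K)) (z : Plane) (s : ℝ) :
    Bornology.IsBounded (rescale z s K) := by
  have h : IsCompact ((fun x => z + s • x) '' closure K) := hc.image (by fun_prop)
  exact h.isBounded.subset (image_mono subset_closure)

lemma isBounded_interior_rescale (hc : IsCompact (closure K)) (z : Plane) (s : ℝ) :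
    Bornology.IsBounded (Opens.interior (rescale z s K) : Set Plane) :=
  (isBounded_rescale hc z s).subset interior_subset

/-- The Poincaré inequality on the rescaled copies of a bounded connected Lipschitz domain. -/
theorem exists_poincare (hK : HasLipschitzBoundary K) (hconn : IsConnected K)
    (hint : (interior K).Nonempty) (hc : IsCompact (closure K)) :
    ∃ C : ℝ, 0 ≤ C ∧ ∀ (z : Plane) (s : ℝ), 0 < s → ∀ Ω : Opens Plane,
      Ω = Opens.interior (rescale z s K) → ∀ u g₀ g₁ : Plane → ℝ, MemL2 Ω u → MemL2 Ω g₀ →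
      MemL2 Ω g₁ → HasWeakDeriv Ω (coordIdx 0) u g₀ → HasWeakDeriv Ω (coordIdx 1) u g₁ →
      ∃ a : ℝ, l2Norm Ω (fun x => u x - a) ^ 2 ≤
        C * s ^ 2 * (l2Norm Ω g₀ ^ 2 + l2Norm Ω g₁ ^ 2) := by
  obtain ⟨C, hC⟩ := linked_interior hK hconn hc
  have hpos : volume (interior K) ≠ 0 := (isOpen_interior.measure_pos volume hint).ne'
  have hfin : volume (interior K) ≠ ⊤ :=
    (hc.isBounded.subset (interior_subset.trans subset_closure)).measure_lt_top.ne
  refine ⟨C / (volume (interior K)).toReal, by positivity, ?_⟩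
  intro z s hs Ω hΩ u g₀ g₁ hu hg₀ hg₁ h₀ h₁
  have hb : Bornology.IsBounded (Ω : Set Plane) := hΩ ▸ isBounded_interior_rescale hc z s
  have hmeas := hu.1.aemeasurable
  -- `Linked` asks for a genuinely measurable function, so u is replaced by a representative.
  set U := hmeas.mk u with hUdef
  have hUm : Measurable U := hmeas.measurable_mk
  have hT := (translationBound_of_hasWeakDeriv (hu.integrableOn hb) (hg₀.integrableOn hb)
    (hg₁.integrableOn hb) h₀ h₁ hmeas.ae_eq_mk).comp_affine (Ω := interior K) z hs
      (fun x hx => by rw [hΩ]; exact (mem_interior_rescale z hs).2 hx)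
  have hE : ∫⁻ x in Ω, (‖g₀ x‖ₑ ^ 2 + ‖g₁ x‖ₑ ^ 2) =
      ENNReal.ofReal (l2Norm Ω g₀ ^ 2 + l2Norm Ω g₁ ^ 2) := by
    rw [lintegral_add_left' (hg₀.1.enorm.pow_const 2), ENNReal.ofReal_add (sq_nonneg _)
      (sq_nonneg _), ofReal_l2Norm_sq hg₀, ofReal_l2Norm_sq hg₁]
  rw [hE] at hT
  have hV : Measurable fun x => U (z + s • x) := hUm.comp (by fun_prop)
  have hL := hC _ _ hV hT
  -- Instead of the mean value, the constant a is the value of U at a point where the inner integral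
  -- does not exceed its average over the reference interior. The average explains the division of C
  -- by the area.
  obtain ⟨x, -, hx⟩ := exists_le_setLAverage hpos hfin
    ((measurable_enorm_sub_sq hV).lintegral_prod_right' (ν := volume.restrict (interior K))).aemeasurable
  dsimp only at hx
  rw [setLAverage_eq] at hx
  replace hx := hx.trans (ENNReal.div_le_div_right hL _)
  refine ⟨U (z + s • x), ?_⟩
  have hmem : MemL2 Ω fun y => u y - U (z + s • x) := by
    have : IsFiniteMeasure (volume.restrict (Ω : Set Plane)) :=
      isFiniteMeasure_restrict.2 hb.measure_lt_top.ne
    exact hu.sub (memLp_const _)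
  rw [lintegral_rescale z hs hΩ (fun y => ‖U (z + s • x) - U y‖ₑ ^ 2)] at hx
  have h1 : ∫⁻ y in Ω, ‖u y - U (z + s • x)‖ₑ ^ 2 = ∫⁻ y in Ω, ‖U (z + s • x) - U y‖ₑ ^ 2 := by
    refine lintegral_congr_ae ?_
    filter_upwards [hmeas.ae_eq_mk] with y hy
    rw [hy, enorm_sub_rev]
  rw [← h1, ← ofReal_l2Norm_sq hmem, ← ENNReal.ofReal_mul (by positivity),
    ← ENNReal.ofReal_coe_nnreal, ← ENNReal.ofReal_mul (by positivity),
    ← ENNReal.ofReal_toReal hfin,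
    ← ENNReal.ofReal_div_of_pos (ENNReal.toReal_pos hpos hfin),
    ENNReal.ofReal_le_ofReal_iff (by positivity), inv_mul_le_iff₀ (by positivity)] at hx
  refine hx.trans (le_of_eq ?_)
  ring

end Poincare

/-! ### Polynomials and their derivatives -/

section Polynomials

open MvPolynomial

lemma polysDegreeLE_eq (m : ℤ) :
    polysDegreeLE m = (restrictSupport ℝ {d : Fin 2 →₀ ℕ | (d.degree : ℤ) ≤ m} :
      Set (MvPolynomial (Fin 2) ℝ)) := by
  ext q
  rw [SetLike.mem_coe, mem_restrictSupport_iff]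
  rfl

/-- Evaluation of polynomials on the plane, as a linear map. -/
noncomputable def polyFunₗ : MvPolynomial (Fin 2) ℝ →ₗ[ℝ] (Plane → ℝ) where
  toFun := polyFun
  map_add' p q := by ext x; simp [polyFun]
  map_smul' c q := by ext x; simp [polyFun, smul_eval]

lemma polyFun_add (p q : MvPolynomial (Fin 2) ℝ) : polyFun (p + q) = polyFun p + polyFun q :=
  polyFunₗ.map_add p q

lemma polyFun_mul_X (p : MvPolynomial (Fin 2) ℝ) (i : Fin 2) :
    polyFun (p * X i) = fun x => polyFun p x * x i := by
  ext x; simp [polyFun]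

lemma contDiff_polyFun (q : MvPolynomial (Fin 2) ℝ) : ContDiff ℝ ∞ (polyFun q) := by
  induction q using MvPolynomial.induction_on with
  | C a =>
    have : polyFun (C a : MvPolynomial (Fin 2) ℝ) = fun _ => a := by ext; simp [polyFun]
    rw [this]
    exact contDiff_const
  | add p q hp hq => rw [polyFun_add]; exact hp.add hq
  | mul_X p i hp => rw [polyFun_mul_X]; exact hp.mul (by fun_prop)

lemma fderiv_polyFun (q : MvPolynomial (Fin 2) ℝ) (i : Fin 2) (x : Plane) :
    fderiv ℝ (polyFun q) x (unitVec i) = polyFun (pderiv i q) x := by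
  induction q using MvPolynomial.induction_on with
  | C a =>
    have : polyFun (C a : MvPolynomial (Fin 2) ℝ) = fun _ => a := by ext; simp [polyFun]
    rw [this]
    simp [polyFun]
  | add p q hp hq =>
    have hd := fun r : MvPolynomial (Fin 2) ℝ => (contDiff_polyFun r).differentiable (by simp) x
    rw [polyFun_add, fderiv_add (hd p) (hd q), map_add, polyFun_add]
    simp [hp, hq]
  | mul_X p j hp =>
    have hd := fun r : MvPolynomial (Fin 2) ℝ => (contDiff_polyFun r).differentiable (by simp) x
    have hX : HasFDerivAt (fun y : Plane => y j) (EuclideanSpace.proj (𝕜 := ℝ) j) x :=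
      (EuclideanSpace.proj j : Plane →L[ℝ] ℝ).hasFDerivAt
    rw [polyFun_mul_X, ((hd p).hasFDerivAt.fun_mul hX).fderiv, pderiv_mul, polyFun_add, polyFun_mul_X]
    simp only [add_apply, smul_apply, hp,
      pderiv_X, Pi.add_apply, smul_eq_mul]
    fin_cases i <;> fin_cases j <;> simp [unitVec, polyFun, mul_comm, add_comm]

/-- The partial derivative in the `i`-th variable, as a linear map. -/
noncomputable def partialₗ (i : Fin 2) : MvPolynomial (Fin 2) ℝ →ₗ[ℝ] MvPolynomial (Fin 2) ℝ :=
  (pderiv (R := ℝ) i).toLinearMap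

/-- The partial derivative `∂^α` of polynomials. -/
noncomputable def polyDeriv (α : ℕ × ℕ) :
    MvPolynomial (Fin 2) ℝ →ₗ[ℝ] MvPolynomial (Fin 2) ℝ :=
  (partialₗ 0 ^ α.1) ∘ₗ (partialₗ 1 ^ α.2)

lemma hasWeakDeriv_polyFun (Ω : Opens Plane) (α : ℕ × ℕ) (q : MvPolynomial (Fin 2) ℝ) :
    HasWeakDeriv Ω α (polyFun q) (polyFun (polyDeriv α q)) := by
  have h1 : ∀ (i : Fin 2) (k : ℕ) (q : MvPolynomial (Fin 2) ℝ),
      HasWeakDeriv Ω (k • coordIdx i) (polyFun q)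
        (polyFun ((partialₗ i ^ k) q)) := by
    intro i k q
    induction k with
    | zero =>
      simpa using HasWeakDeriv.zero
        ((contDiff_polyFun q).continuous.locallyIntegrable.locallyIntegrableOn (μ := volume) _)
    | succ k ih =>
      rw [succ_nsmul, pow_succ', Module.End.mul_apply]
      refine ih.trans ?_
      have := ContDiff.hasWeakDeriv (Ω := Ω) (contDiff_polyFun ((partialₗ i ^ k) q)) i
      simp only [fderiv_polyFun] at this
      exact this
  have h2 := (h1 1 α.2 q).trans (h1 0 α.1 _)
  have h3 : α.2 • coordIdx 1 + α.1 • coordIdx 0 = α := by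
    ext <;> simp [coordIdx]
  rw [h3] at h2
  exact h2

lemma pderiv_pow_monomial (i : Fin 2) (k : ℕ) (d : Fin 2 →₀ ℕ) (a : ℝ) :
    (partialₗ i ^ k) (monomial d a) =
      monomial (d - Finsupp.single i k) (a * (d i).descFactorial k) := by
  induction k with
  | zero => simp
  | succ k ih =>
    rw [pow_succ', Module.End.mul_apply, ih]
    change pderiv i _ = _
    rw [pderiv_monomial, tsub_tsub, ← Finsupp.single_add, Nat.descFactorial_succ]
    congr 1
    simp only [Finsupp.tsub_apply, Finsupp.single_eq_same]
    push_cast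
    ring

/-- The monomial `x^α / α!`. -/
noncomputable def monicMonomial (α : ℕ × ℕ) : MvPolynomial (Fin 2) ℝ :=
  monomial (Finsupp.single 0 α.1 + Finsupp.single 1 α.2) ((α.1.factorial * α.2.factorial : ℝ)⁻¹)

/-- At a fixed order these monomials are dual to the derivatives, so a polynomial with prescribed
constant derivatives of that order can be written down directly. -/
lemma polyDeriv_monicMonomial {α β : ℕ × ℕ} (h : α.1 + α.2 = β.1 + β.2) :
    polyDeriv β (monicMonomial α) = if α = β then 1 else 0 := by
  rw [polyDeriv, monicMonomial, LinearMap.comp_apply, pderiv_pow_monomial, pderiv_pow_monomial]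
  split_ifs with hαβ
  · subst hαβ
    have hd : (Finsupp.single 0 α.1 + Finsupp.single 1 α.2 - Finsupp.single 1 α.2 -
        Finsupp.single 0 α.1 : Fin 2 →₀ ℕ) = 0 := by simp
    rw [hd]
    have h1 := Nat.factorial_ne_zero α.1
    have h2 := Nat.factorial_ne_zero α.2
    refine (congrArg (monomial 0) ?_).trans C_1
    simp [Nat.descFactorial_self]
    field_simp
  · rw [monomial_eq_zero]
    have : α.1 < β.1 ∨ α.2 < β.2 := by
      by_contra! hc
      exact hαβ (Prod.ext (by omega) (by omega))
    rcases this with h1 | h1 <;> simp [Nat.descFactorial_of_lt h1]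

lemma monicMonomial_mem (α : ℕ × ℕ) {m : ℤ} (h : ((α.1 + α.2 : ℕ) : ℤ) ≤ m) :
    monicMonomial α ∈ restrictSupport ℝ {d : Fin 2 →₀ ℕ | (d.degree : ℤ) ≤ m} := by
  refine (monomial_mem_restrictSupport ℝ).2 (Or.inl ?_)
  simpa using h

end Polynomials

/-! ### Approximation by polynomials (Deny–Lions) -/

section DenyLions

variable {K : Set Plane} {Ω : Opens Plane}

lemma _root_.Continuous.memL2 {f : Plane → ℝ} (hf : Continuous f)
    (hΩ : Bornology.IsBounded (Ω : Set Plane)) : MemL2 Ω f := by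
  have : IsFiniteMeasure (volume.restrict (Ω : Set Plane)) :=
    isFiniteMeasure_restrict.2 hΩ.measure_lt_top.ne
  obtain ⟨M, hM⟩ := hΩ.isCompact_closure.exists_bound_of_continuousOn hf.continuousOn
  refine MemLp.of_bound hf.aestronglyMeasurable M ?_
  exact ae_restrict_of_forall_mem Ω.isOpen.measurableSet fun x hx => hM x (subset_closure hx)

open MvPolynomial in
/-- The approximation of Sobolev functions by polynomials on the rescaled copies of a bounded
connected Lipschitz domain. -/
theorem exists_polynomial_approximation (hK : HasLipschitzBoundary K) (hconn : IsConnected K)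
    (hint : (interior K).Nonempty) (hc : IsCompact (closure K)) (m : ℕ) :
    ∃ C : ℝ, 0 ≤ C ∧ ∀ (z : Plane) (s : ℝ), 0 < s → ∀ Ω : Opens Plane,
      Ω = Opens.interior (rescale z s K) → ∀ g : Plane → ℝ, MemH m Ω g →
      ∃ q ∈ polysDegreeLE ((m : ℤ) - 1),
        l2Norm Ω (fun x => g x - polyFun q x) ≤ C * s ^ m * sobolevSeminorm m Ω g := by
  obtain ⟨P, hP0, hP⟩ := exists_poincare hK hconn hint hc
  induction m with
  | zero =>
    -- In order 0 the degree bound is −1, which leaves only the zero polynomial, and the seminorm is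
    -- the L² norm.
    refine ⟨1, zero_le_one, fun z s hs Ω hΩ g hg => ⟨0, fun d hd => by simp at hd, ?_⟩⟩
    obtain ⟨k, hk, hk'⟩ := hg.2 0 (by simp)
    have h0 := HasWeakDeriv.zero hk'.1
    have h1 : sobolevSeminorm 0 Ω g ^ 2 = l2Norm Ω g ^ 2 := by
      rw [sobolevSeminorm_sq (D := fun _ => g)] <;> simp
      exact ⟨hg.1, h0⟩
    have h2 := (pow_left_inj₀ (sobolevSeminorm_nonneg _ _ _) (l2Norm_nonneg _ _) two_ne_zero).1 h1
    simp [h2, polyFun]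
  | succ m ih =>
    obtain ⟨C, hC0, hC⟩ := ih
    refine ⟨C * √(2 * P), by positivity, fun z s hs Ω hΩ g hg => ?_⟩
    have hb : Bornology.IsBounded (Ω : Set Plane) := hΩ ▸ isBounded_interior_rescale hc z s
    choose! D hDm hD using hg.2
    have hstep : ∀ α : ℕ × ℕ, α.1 + α.2 = m → ∃ a : ℝ, l2Norm Ω (fun x => D α x - a) ^ 2 ≤
        P * s ^ 2 * (l2Norm Ω (D (α + coordIdx 0)) ^ 2 + l2Norm Ω (D (α + coordIdx 1)) ^ 2) := by
      intro α hα
      have e0 : (α + coordIdx 0).1 + (α + coordIdx 0).2 ≤ m + 1 := by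
        simp only [coordIdx, Matrix.cons_val_zero, Prod.fst_add, Prod.snd_add]; omega
      have e1 : (α + coordIdx 1).1 + (α + coordIdx 1).2 ≤ m + 1 := by
        simp only [coordIdx, Matrix.cons_val_one, Matrix.cons_val_zero, Prod.fst_add,
          Prod.snd_add]; omega
      have hα' := hD α (by omega)
      exact hP z s hs Ω hΩ _ _ _ (hDm α (by omega)) (hDm _ e0) (hDm _ e1)
        (hα'.of_add (hD _ e0)) (hα'.of_add (hD _ e1))
    choose! a ha using hstep
    -- The derivatives of q₁ of order m are the constants a from the Poincaré inequality.
    -- Subtracting q₁ makes the seminorm of order m small, and the induction hypothesis applies to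
    -- the remainder.
    set q₁ : MvPolynomial (Fin 2) ℝ :=
      ∑ α ∈ Finset.HasAntidiagonal.antidiagonal m, a α • monicMonomial α with hq₁
    have hq₁D : ∀ β : ℕ × ℕ, β.1 + β.2 = m → polyFun (polyDeriv β q₁) = fun _ => a β := by
      intro β hβ
      have : polyDeriv β q₁ = a β • 1 := by
        rw [hq₁, map_sum, Finset.sum_eq_single β]
        · rw [map_smul, polyDeriv_monicMonomial rfl, if_pos rfl]
        · intro α hα hαβ
          rw [map_smul, polyDeriv_monicMonomial ((Finset.HasAntidiagonal.mem_antidiagonal.1 hα).trans hβ.symm),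
            if_neg hαβ, smul_zero]
        · intro h
          exact absurd (Finset.HasAntidiagonal.mem_antidiagonal.2 hβ) h
      rw [this]
      ext x
      simp [polyFun, smul_eval]
    have hDm' : ∀ α : ℕ × ℕ, α.1 + α.2 ≤ m →
        MemL2 Ω fun x => D α x - polyFun (polyDeriv α q₁) x := fun α hα =>
      (hDm α (by omega)).sub ((contDiff_polyFun _).continuous.memL2 hb)
    have hD' : ∀ α : ℕ × ℕ, α.1 + α.2 ≤ m → HasWeakDeriv Ω α (fun x => g x - polyFun q₁ x)
        fun x => D α x - polyFun (polyDeriv α q₁) x := fun α hα =>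
      (hD α (by omega)).sub (hasWeakDeriv_polyFun Ω α q₁)
    have hg' : MemH m Ω fun x => g x - polyFun q₁ x :=
      ⟨hg.1.sub ((contDiff_polyFun _).continuous.memL2 hb), fun α hα => ⟨_, hDm' α hα, hD' α hα⟩⟩
    obtain ⟨q₂, hq₂, hle⟩ := hC z s hs Ω hΩ _ hg'
    have hsemi : sobolevSeminorm m Ω (fun x => g x - polyFun q₁ x) ≤
        √(2 * P) * s * sobolevSeminorm (m + 1) Ω g := by
      refine (pow_le_pow_iff_left₀ (sobolevSeminorm_nonneg _ _ _)
        (mul_nonneg (by positivity) (sobolevSeminorm_nonneg _ _ _)) two_ne_zero).1 ?_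
      rw [mul_pow, mul_pow, Real.sq_sqrt (by positivity),
        sobolevSeminorm_sq (D := D) (k := m + 1) (fun α hα =>
          have h := (Finset.HasAntidiagonal.mem_antidiagonal.1 hα).le
          ⟨hDm α h, hD α h⟩),
        sobolevSeminorm_sq (D := fun α x => D α x - polyFun (polyDeriv α q₁) x) (k := m)
          (fun α hα =>
            have h := (Finset.HasAntidiagonal.mem_antidiagonal.1 hα).le
            ⟨hDm' α h, hD' α h⟩)]
      set S := ∑ α ∈ Finset.HasAntidiagonal.antidiagonal (m + 1), l2Norm Ω (D α) ^ 2 with hS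
      -- Each shift of multi-indices is injective into order m + 1, so each of the two sums is at
      -- most S. Together they give the 2 in √(2P).
      have s0 : ∑ α ∈ Finset.HasAntidiagonal.antidiagonal m, l2Norm Ω (D (α + coordIdx 0)) ^ 2
          ≤ S := by
        rw [hS, Finset.Nat.sum_antidiagonal_succ]
        exact le_add_of_nonneg_left (sq_nonneg _)
      have s1 : ∑ α ∈ Finset.HasAntidiagonal.antidiagonal m, l2Norm Ω (D (α + coordIdx 1)) ^ 2
          ≤ S := by
        rw [hS, Finset.Nat.sum_antidiagonal_succ']
        exact le_add_of_nonneg_left (sq_nonneg _)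
      calc ∑ α ∈ Finset.HasAntidiagonal.antidiagonal m,
            l2Norm Ω (fun x => D α x - polyFun (polyDeriv α q₁) x) ^ 2
          ≤ ∑ α ∈ Finset.HasAntidiagonal.antidiagonal m, P * s ^ 2 *
            (l2Norm Ω (D (α + coordIdx 0)) ^ 2 + l2Norm Ω (D (α + coordIdx 1)) ^ 2) := by
            refine Finset.sum_le_sum fun α hα => ?_
            have hα := Finset.HasAntidiagonal.mem_antidiagonal.1 hα
            rw [hq₁D α hα]
            exact ha α hα
        _ = P * s ^ 2 * (∑ α ∈ Finset.HasAntidiagonal.antidiagonal m,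
              l2Norm Ω (D (α + coordIdx 0)) ^ 2 +
            ∑ α ∈ Finset.HasAntidiagonal.antidiagonal m,
              l2Norm Ω (D (α + coordIdx 1)) ^ 2) := by
            rw [← Finset.mul_sum, Finset.sum_add_distrib]
        _ ≤ P * s ^ 2 * (S + S) := by gcongr
        _ = 2 * P * s ^ 2 * S := by ring
    refine ⟨q₁ + q₂, ?_, ?_⟩
    · rw [polysDegreeLE_eq, SetLike.mem_coe] at hq₂ ⊢
      refine Submodule.add_mem _ (Submodule.sum_mem _ fun α hα => Submodule.smul_mem _ _
        (monicMonomial_mem α ?_)) (restrictSupport_mono ℝ (fun d hd => ?_) hq₂)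
      · rw [Finset.HasAntidiagonal.mem_antidiagonal.1 hα]; push_cast; omega
      · have hd : (d.degree : ℤ) ≤ (m : ℤ) - 1 := hd
        change (d.degree : ℤ) ≤ ((m + 1 : ℕ) : ℤ) - 1
        push_cast; omega
    · have h1 : (fun x => g x - polyFun (q₁ + q₂) x) =
          fun x => g x - polyFun q₁ x - polyFun q₂ x := by
        ext x; rw [polyFun_add, Pi.add_apply]; ring
      rw [h1]
      refine hle.trans ((mul_le_mul_of_nonneg_left hsemi (by positivity)).trans (le_of_eq ?_))
      ring

end DenyLions

/-! ### H¹₀ as a Hilbert space and the Friedrichs inequality -/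

section Dirichlet

open scoped RealInnerProductSpace

/-- The Hilbert space `L²(Ω)`. -/
abbrev L2 (Ω : Opens Plane) : Type := Lp ℝ 2 (volume.restrict (Ω : Set Plane))

/-- The Hilbert space `L²(Ω)³` of triples consisting of a function and a gradient. -/
abbrev GradSpace (Ω : Opens Plane) : Type := PiLp 2 fun _ : Fin 3 => L2 Ω

variable {Ω : Opens Plane} {f g u b₀ b₁ : Plane → ℝ}

lemma memL2_testFunction (φ : 𝓓(Ω, ℝ)) : MemL2 Ω φ :=
  φ.continuous.memLp_of_hasCompactSupport φ.hasCompactSupport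

lemma norm_toLp_eq_l2Norm (hf : MemL2 Ω f) : ‖(MemLp.toLp f hf : L2 Ω)‖ = l2Norm Ω f :=
  (Lp.norm_toLp f hf).trans (toReal_eLpNorm hf.1)

lemma inner_eq_integral {x y : L2 Ω} (hx : x =ᵐ[volume.restrict Ω] f)
    (hy : y =ᵐ[volume.restrict Ω] g) : ⟪x, y⟫ = ∫ a in Ω, f a * g a := by
  rw [L2.inner_def]
  refine integral_congr_ae ?_
  filter_upwards [hx, hy] with a ha hb
  simp [ha, hb, mul_comm]

/-- Test functions as elements of `L²(Ω)`. -/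
noncomputable def testToL2 : 𝓓(Ω, ℝ) →ₗ[ℝ] L2 Ω where
  toFun φ := (memL2_testFunction φ).toLp φ
  map_add' _ _ := rfl
  map_smul' _ _ := rfl

lemma coeFn_testToL2 (φ : 𝓓(Ω, ℝ)) : testToL2 φ =ᵐ[volume.restrict Ω] φ :=
  (memL2_testFunction φ).coeFn_toLp

/-- Test functions with their gradients. -/
noncomputable def testToGrad : 𝓓(Ω, ℝ) →ₗ[ℝ] GradSpace Ω where
  toFun φ := WithLp.toLp 2 ![testToL2 φ, testToL2 (∂_{unitVec 0} φ), testToL2 (∂_{unitVec 1} φ)]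
  map_add' φ ψ := by
    ext1 i
    fin_cases i <;> simp [LineDeriv.lineDerivOp_add]
  map_smul' c φ := by
    ext1 i
    fin_cases i <;> simp [LineDeriv.lineDerivOp_smul]

/-- `H¹₀(Ω)` as a closed subspace of `L²(Ω)³`. -/
noncomputable def H10 (Ω : Opens Plane) : Submodule ℝ (GradSpace Ω) :=
  (LinearMap.range (testToGrad (Ω := Ω))).topologicalClosure

lemma testToGrad_mem (φ : 𝓓(Ω, ℝ)) : testToGrad φ ∈ H10 Ω :=
  Submodule.le_topologicalClosure _ ⟨φ, rfl⟩

lemma H10_induction {P : GradSpace Ω → Prop} (hP : IsClosed {m | P m})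
    (h : ∀ φ : 𝓓(Ω, ℝ), P (testToGrad φ)) {m : GradSpace Ω} (hm : m ∈ H10 Ω) : P m := by
  have hsub : closure (LinearMap.range (testToGrad (Ω := Ω)) : Set (GradSpace Ω)) ⊆ {m | P m} :=
    closure_minimal (by rintro _ ⟨φ, rfl⟩; exact h φ) hP
  exact hsub hm

lemma norm_gradSpace_sq (m : GradSpace Ω) :
    ‖m‖ ^ 2 = ‖m 0‖ ^ 2 + (‖m 1‖ ^ 2 + ‖m 2‖ ^ 2) := by
  rw [PiLp.norm_sq_eq_of_L2, Fin.sum_univ_three, add_assoc]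

lemma testFunction_hasWeakDeriv (φ : 𝓓(Ω, ℝ)) (i : Fin 2) :
    HasWeakDeriv Ω (coordIdx i) φ (∂_{unitVec i} φ : 𝓓(Ω, ℝ)) := by
  have h : ((∂_{unitVec i} φ : 𝓓(Ω, ℝ)) : Plane → ℝ) = fun x => fderiv ℝ φ x (unitVec i) :=
    funext fun x => lineDerivOp_apply φ _ x
  rw [h]
  exact ContDiff.hasWeakDeriv φ.contDiff i

/-- The Poincaré–Friedrichs inequality for test functions. -/
lemma friedrichs_testFunction {D : ℝ} (hD : 0 < D)
    (hΩ : ∀ x ∈ (Ω : Set Plane), ∀ y ∈ (Ω : Set Plane), dist x y ≤ D) (φ : 𝓓(Ω, ℝ)) :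
    l2Norm Ω φ ^ 2 ≤ (2 * D) ^ 2 *
      (l2Norm Ω (∂_{unitVec 0} φ : 𝓓(Ω, ℝ)) ^ 2 + l2Norm Ω (∂_{unitVec 1} φ : 𝓓(Ω, ℝ)) ^ 2) := by
  have hint : ∀ ψ : 𝓓(Ω, ℝ), IntegrableOn ψ ((⊤ : Opens Plane) : Set Plane) := fun ψ =>
    (ψ.continuous.integrable_of_hasCompactSupport ψ.hasCompactSupport).integrableOn
  have hwd : ∀ i : Fin 2, HasWeakDeriv ⊤ (coordIdx i) φ (∂_{unitVec i} φ : 𝓓(Ω, ℝ)) := fun i => by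
    have h : ((∂_{unitVec i} φ : 𝓓(Ω, ℝ)) : Plane → ℝ) = fun x => fderiv ℝ φ x (unitVec i) :=
      funext fun x => lineDerivOp_apply φ _ x
    rw [h]
    exact ContDiff.hasWeakDeriv φ.contDiff i
  -- A shift by 2D moves Ω off itself, so on Ω the increment of φ is just −φ. The translation bound
  -- is used on the whole plane, where φ extends by zero.
  have hT := translationBound_of_hasWeakDeriv (hint φ) (hint _) (hint _) (hwd 0) (hwd 1) ae_eq_rfl
    univ ((2 * D) • unitVec 0) isOpen_univ (fun _ _ _ _ => mem_univ _)
  have hnorm : ‖(2 * D) • unitVec 0‖ = 2 * D := by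
    rw [norm_smul, unitVec, PiLp.norm_single, norm_one, mul_one, Real.norm_of_nonneg (by positivity)]
  have hout : ∀ x ∈ (Ω : Set Plane), φ (x + (2 * D) • unitVec 0) = 0 := by
    intro x hx
    refine testFunction_eq_zero φ fun hx' => ?_
    have := hΩ _ hx' x hx
    rw [dist_eq_norm, add_sub_cancel_left, hnorm] at this
    linarith
  have hΩm := Ω.isOpen.measurableSet
  have hset : ∫⁻ x in ((⊤ : Opens Plane) : Set Plane), (‖(∂_{unitVec 0} φ : 𝓓(Ω, ℝ)) x‖ₑ ^ 2 +
        ‖(∂_{unitVec 1} φ : 𝓓(Ω, ℝ)) x‖ₑ ^ 2) =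
      ENNReal.ofReal (l2Norm Ω (∂_{unitVec 0} φ : 𝓓(Ω, ℝ)) ^ 2 +
        l2Norm Ω (∂_{unitVec 1} φ : 𝓓(Ω, ℝ)) ^ 2) := by
    rw [ENNReal.ofReal_add (sq_nonneg _) (sq_nonneg _), ofReal_l2Norm_sq (memL2_testFunction _),
      ofReal_l2Norm_sq (memL2_testFunction _),
      ← lintegral_add_left' ((memL2_testFunction (∂_{unitVec 0} φ : 𝓓(Ω, ℝ))).1.enorm.pow_const 2),
      ← lintegral_indicator hΩm, Opens.coe_top, Measure.restrict_univ]
    refine lintegral_congr fun x => ?_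
    by_cases hx : x ∈ (Ω : Set Plane)
    · rw [indicator_of_mem hx]
    · rw [indicator_of_notMem hx, testFunction_eq_zero _ hx, testFunction_eq_zero _ hx]
      simp
  have h1 : ENNReal.ofReal (l2Norm Ω φ ^ 2) ≤
      ∫⁻ x in univ, ‖φ (x + (2 * D) • unitVec 0) - φ x‖ₑ ^ 2 := by
    rw [ofReal_l2Norm_sq (memL2_testFunction φ)]
    refine le_trans (le_of_eq ?_) (lintegral_mono_set (subset_univ (Ω : Set Plane)))
    refine setLIntegral_congr_fun hΩm fun x hx => ?_
    simp only [hout x hx, zero_sub, enorm_neg]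
  rw [hset, ← ofReal_norm, hnorm, ← ENNReal.ofReal_pow (by positivity),
    ← ENNReal.ofReal_mul (by positivity)] at hT
  exact (ENNReal.ofReal_le_ofReal_iff (by positivity)).1 (h1.trans hT)

lemma friedrichs {D : ℝ} (hD : 0 < D)
    (hΩ : ∀ x ∈ (Ω : Set Plane), ∀ y ∈ (Ω : Set Plane), dist x y ≤ D) {m : GradSpace Ω}
    (hm : m ∈ H10 Ω) : ‖m 0‖ ^ 2 ≤ (2 * D) ^ 2 * (‖m 1‖ ^ 2 + ‖m 2‖ ^ 2) := by
  refine H10_induction (P := fun m => ‖m 0‖ ^ 2 ≤ (2 * D) ^ 2 * (‖m 1‖ ^ 2 + ‖m 2‖ ^ 2)) ?_ ?_ hm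
  · exact isClosed_le (by fun_prop) (by fun_prop)
  · intro φ
    have := friedrichs_testFunction hD hΩ φ
    simp only [← norm_toLp_eq_l2Norm (memL2_testFunction _)] at this
    exact this

/-- For a fixed test function both sides are L² inner products, so integration by parts passes from
test functions to their closure. -/
lemma hasWeakDeriv_of_mem_H10 (hb : Bornology.IsBounded (Ω : Set Plane)) {m : GradSpace Ω}
    (hm : m ∈ H10 Ω) (i : Fin 2) : HasWeakDeriv Ω (coordIdx i) (m 0) (m i.succ) := by
  have hl : ∀ x : L2 Ω, LocallyIntegrableOn x Ω := fun x =>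
    (MemL2.integrableOn hb (Lp.memLp x)).locallyIntegrableOn
  refine ⟨hl _, hl _, fun φ => ?_⟩
  have key : ⟪m 0, testToL2 (testDeriv (coordIdx i) φ)⟫ = -⟪m i.succ, testToL2 φ⟫ := by
    refine H10_induction (P := fun m => ⟪m 0, testToL2 (testDeriv (coordIdx i) φ)⟫ =
      -⟪m i.succ, testToL2 φ⟫) ?_ ?_ hm
    · exact isClosed_eq (by fun_prop) (by fun_prop)
    · intro ψ
      have h := (testFunction_hasWeakDeriv ψ i).2.2 φ
      have h1 : (testToGrad ψ) i.succ = testToL2 (∂_{unitVec i} ψ) := by fin_cases i <;> rfl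
      change ⟪testToL2 ψ, _⟫ = _
      rw [h1, inner_eq_integral (coeFn_testToL2 _) (coeFn_testToL2 _),
        inner_eq_integral (coeFn_testToL2 _) (coeFn_testToL2 _), h]
      fin_cases i <;> simp [coordIdx]
  rw [inner_eq_integral ae_eq_rfl (coeFn_testToL2 _),
    inner_eq_integral ae_eq_rfl (coeFn_testToL2 _)] at key
  rw [key]
  fin_cases i <;> simp [coordIdx]

lemma memH_one_of_hasWeakDeriv (hu : MemL2 Ω u) (hb₀ : MemL2 Ω b₀) (hb₁ : MemL2 Ω b₁)
    (h₀ : HasWeakDeriv Ω (coordIdx 0) u b₀) (h₁ : HasWeakDeriv Ω (coordIdx 1) u b₁) :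
    MemH 1 Ω u := by
  refine ⟨hu, ?_⟩
  rintro ⟨i, j⟩ hij
  have hij' : (i = 0 ∧ j = 0) ∨ (i = 1 ∧ j = 0) ∨ (i = 0 ∧ j = 1) := by
    dsimp only at hij; omega
  rcases hij' with ⟨rfl, rfl⟩ | ⟨rfl, rfl⟩ | ⟨rfl, rfl⟩
  · exact ⟨u, hu, HasWeakDeriv.zero h₀.1⟩
  · exact ⟨b₀, hb₀, h₀⟩
  · exact ⟨b₁, hb₁, h₁⟩

/-- This makes the convergence demanded by `MemH10` the same as norm convergence in `GradSpace`,
which identifies `MemH10` with `H10` in both directions. -/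
lemma norm_testToGrad_sub_sq (φ : 𝓓(Ω, ℝ)) {m : GradSpace Ω}
    (hu : m 0 =ᵐ[volume.restrict Ω] u) (h₀ : HasWeakDeriv Ω (coordIdx 0) u (m 1))
    (h₁ : HasWeakDeriv Ω (coordIdx 1) u (m 2)) :
    ‖testToGrad φ - m‖ ^ 2 =
      l2Norm Ω (fun x => φ x - u x) ^ 2 + sobolevSeminorm 1 Ω (fun x => φ x - u x) ^ 2 := by
  have hn : ∀ (ψ : 𝓓(Ω, ℝ)) (x : L2 Ω) (k : Plane → ℝ), x =ᵐ[volume.restrict Ω] k →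
      ‖testToL2 ψ - x‖ = l2Norm Ω (fun a => ψ a - k a) := by
    intro ψ x k hk
    rw [Lp.norm_def, toReal_eLpNorm (Lp.aestronglyMeasurable _)]
    refine l2Norm_congr ?_
    filter_upwards [Lp.coeFn_sub (testToL2 ψ) x, coeFn_testToL2 ψ, hk] with a h1 h2 h3
    rw [h1, Pi.sub_apply, h2, h3]
  have hL : ∀ (ψ : 𝓓(Ω, ℝ)) (x : L2 Ω), MemL2 Ω fun a => ψ a - x a := fun ψ x =>
    (memL2_testFunction ψ).sub (Lp.memLp x)
  rw [norm_gradSpace_sq, sobolevSeminorm_one_sq ((testFunction_hasWeakDeriv φ 0).sub h₀)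
    (hL _ _) ((testFunction_hasWeakDeriv φ 1).sub h₁) (hL _ _), ← hn φ _ _ hu,
    ← hn (∂_{unitVec 0} φ) _ _ ae_eq_rfl, ← hn (∂_{unitVec 1} φ) _ _ ae_eq_rfl]
  rfl

lemma memH10_of_mem_H10 (hb : Bornology.IsBounded (Ω : Set Plane)) {m : GradSpace Ω}
    (hm : m ∈ H10 Ω) : MemH10 Ω (m 0) := by
  have h₀ := hasWeakDeriv_of_mem_H10 hb hm 0
  have h₁ := hasWeakDeriv_of_mem_H10 hb hm 1
  refine ⟨memH_one_of_hasWeakDeriv (Lp.memLp _) (Lp.memLp _) (Lp.memLp _) h₀ h₁, ?_⟩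
  obtain ⟨x, hx, hlim⟩ := mem_closure_iff_seq_limit.1 hm
  choose φ hφ using hx
  have hz : Tendsto (fun n => ‖testToGrad (φ n) - m‖) atTop (𝓝 0) := by
    simp only [hφ]
    exact tendsto_iff_norm_sub_tendsto_zero.1 hlim
  have hsq := fun n => norm_testToGrad_sub_sq (φ n) ae_eq_rfl h₀ h₁
  refine ⟨φ, squeeze_zero (fun n => l2Norm_nonneg _ _) (fun n => ?_) hz,
    squeeze_zero (fun n => sobolevSeminorm_nonneg _ _ _) (fun n => ?_) hz⟩
  · exact le_of_sq_le_sq (by rw [hsq n]; exact le_add_of_nonneg_right (sq_nonneg _)) (norm_nonneg _)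
  · exact le_of_sq_le_sq (by rw [hsq n]; exact le_add_of_nonneg_left (sq_nonneg _)) (norm_nonneg _)

lemma HasWeakDeriv.congr_right {α : ℕ × ℕ} (h : HasWeakDeriv Ω α u f)
    (hg : LocallyIntegrableOn g Ω) (hfg : f =ᵐ[volume.restrict Ω] g) : HasWeakDeriv Ω α u g := by
  refine ⟨h.1, hg, fun φ => ?_⟩
  rw [h.2.2 φ]
  congr 1
  refine integral_congr_ae ?_
  filter_upwards [hfg] with x hx
  rw [hx]

lemma MemH10.exists_mem_H10 (hb : Bornology.IsBounded (Ω : Set Plane)) (hu : MemH10 Ω u) :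
    ∃ m ∈ H10 Ω, m 0 =ᵐ[volume.restrict Ω] u ∧ HasWeakDeriv Ω (coordIdx 0) u (m 1) ∧
      HasWeakDeriv Ω (coordIdx 1) u (m 2) := by
  obtain ⟨⟨hu2, hder⟩, φ, hφ0, hφ1⟩ := hu
  obtain ⟨b₀, hb₀, h₀⟩ := hder (1, 0) le_rfl
  obtain ⟨b₁, hb₁, h₁⟩ := hder (0, 1) le_rfl
  have hl : ∀ x : L2 Ω, LocallyIntegrableOn x Ω := fun x =>
    (MemL2.integrableOn hb (Lp.memLp x)).locallyIntegrableOn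
  set m : GradSpace Ω :=
    WithLp.toLp 2 ![MemLp.toLp u hu2, MemLp.toLp b₀ hb₀, MemLp.toLp b₁ hb₁] with hm
  have hm0 : m 0 =ᵐ[volume.restrict Ω] u := MemLp.coeFn_toLp hu2
  have hm1 : HasWeakDeriv Ω (coordIdx 0) u (m 1) :=
    HasWeakDeriv.congr_right h₀ (hl _) (MemLp.coeFn_toLp hb₀).symm
  have hm2 : HasWeakDeriv Ω (coordIdx 1) u (m 2) :=
    HasWeakDeriv.congr_right h₁ (hl _) (MemLp.coeFn_toLp hb₁).symm
  refine ⟨m, ?_, hm0, hm1, hm2⟩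
  have hsq := fun n => norm_testToGrad_sub_sq (φ n) hm0 hm1 hm2
  have hlim : Tendsto (fun n => ‖testToGrad (φ n) - m‖ ^ 2) atTop (𝓝 0) := by
    simp only [hsq]
    simpa using (hφ0.pow 2).add (hφ1.pow 2)
  have hlim' : Tendsto (fun n => testToGrad (φ n)) atTop (𝓝 m) := by
    rw [tendsto_iff_norm_sub_tendsto_zero]
    simpa using hlim.sqrt
  exact mem_closure_of_tendsto hlim' (Eventually.of_forall fun n => ⟨φ n, rfl⟩)

end Dirichlet

/-! ### The Dirichlet problem: existence and energy estimate -/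

section WeakSolutions

open scoped RealInnerProductSpace

variable {Ω : Opens Plane} {f g u b₀ b₁ : Plane → ℝ}

lemma integral_mul_laplacian (h₀ : HasWeakDeriv Ω (coordIdx 0) u b₀)
    (h₁ : HasWeakDeriv Ω (coordIdx 1) u b₁) (φ : 𝓓(Ω, ℝ)) :
    ∫ x in Ω, u x * (testDeriv (2, 0) φ x + testDeriv (0, 2) φ x) =
      -((∫ x in Ω, b₀ x * (∂_{unitVec 0} φ : 𝓓(Ω, ℝ)) x) +
        ∫ x in Ω, b₁ x * (∂_{unitVec 1} φ : 𝓓(Ω, ℝ)) x) := by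
  have e0 : testDeriv (2, 0) φ = testDeriv (coordIdx 0) (∂_{unitVec 0} φ) := rfl
  have e1 : testDeriv (0, 2) φ = testDeriv (coordIdx 1) (∂_{unitVec 1} φ) := rfl
  simp only [mul_add]
  rw [integral_add (integrable_mul_testFunction h₀.1 _) (integrable_mul_testFunction h₀.1 _),
    e0, e1, h₀.2.2, h₁.2.2]
  simp only [coordIdx]
  norm_num
  ring

/-- The distributional equation allows only test functions; density extends it to H¹₀, so that the
solution itself may be inserted. -/
lemma inner_grad_eq_neg_inner (hf : MemL2 Ω f) (h : HasWeakLaplacian Ω u f) {m : GradSpace Ω}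
    (h₀ : HasWeakDeriv Ω (coordIdx 0) u (m 1)) (h₁ : HasWeakDeriv Ω (coordIdx 1) u (m 2))
    {k : GradSpace Ω} (hk : k ∈ H10 Ω) :
    ⟪m 1, k 1⟫ + ⟪m 2, k 2⟫ = -⟪(MemLp.toLp f hf : L2 Ω), k 0⟫ := by
  refine H10_induction (P := fun k => ⟪m 1, k 1⟫ + ⟪m 2, k 2⟫ =
    -⟪(MemLp.toLp f hf : L2 Ω), k 0⟫) ?_ ?_ hk
  · exact isClosed_eq (by fun_prop) (by fun_prop)
  · intro φ
    change ⟪m 1, testToL2 _⟫ + ⟪m 2, testToL2 _⟫ = -⟪_, testToL2 _⟫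
    rw [inner_eq_integral ae_eq_rfl (coeFn_testToL2 _),
      inner_eq_integral ae_eq_rfl (coeFn_testToL2 _),
      inner_eq_integral (MemLp.coeFn_toLp hf) (coeFn_testToL2 _), ← h.2.2 φ,
      integral_mul_laplacian h₀ h₁, neg_neg]

/-- Weak solvability of the Dirichlet problem. -/
theorem exists_solvesDirichlet (hb : Bornology.IsBounded (Ω : Set Plane)) {D : ℝ} (hD : 0 < D)
    (hΩ : ∀ x ∈ (Ω : Set Plane), ∀ y ∈ (Ω : Set Plane), dist x y ≤ D) (hf : MemL2 Ω f) :
    ∃ w, SolvesDirichlet Ω f w := by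
  have hclosed : IsClosed (H10 Ω : Set (GradSpace Ω)) := Submodule.isClosed_topologicalClosure _
  have : CompleteSpace (H10 Ω) := hclosed.completeSpace_coe
  set P : Fin 3 → (H10 Ω →L[ℝ] L2 Ω) := fun i =>
    (PiLp.proj 2 (fun _ : Fin 3 => L2 Ω) i : GradSpace Ω →L[ℝ] L2 Ω).comp (H10 Ω).subtypeL with hP
  have hPa : ∀ i (k : H10 Ω), P i k = (k : GradSpace Ω) i := fun i k => rfl
  set B : H10 Ω →L[ℝ] H10 Ω →L[ℝ] ℝ :=
    (innerSL ℝ).bilinearComp (P 1) (P 1) + (innerSL ℝ).bilinearComp (P 2) (P 2) with hB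
  have hBa : ∀ k l : H10 Ω, B k l = ⟪(k : GradSpace Ω) 1, (l : GradSpace Ω) 1⟫ +
      ⟪(k : GradSpace Ω) 2, (l : GradSpace Ω) 2⟫ := fun k l => rfl
  -- The full norm includes the function, which Friedrichs bounds by (2D)² times the gradient part;
  -- the constant is 1/((2D)² + 1).
  have hcoer : IsCoercive B := by
    refine ⟨((2 * D) ^ 2 + 1)⁻¹, by positivity, fun k => ?_⟩
    rw [hBa, real_inner_self_eq_norm_sq, real_inner_self_eq_norm_sq, mul_assoc, ← sq,
      inv_mul_le_iff₀ (by positivity), Submodule.coe_norm, norm_gradSpace_sq]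
    linarith [friedrichs hD hΩ k.2]
  set F : L2 Ω := MemLp.toLp f hf with hF
  set ℓ : H10 Ω →L[ℝ] ℝ := -((innerSL ℝ F).comp (P 0)) with hℓ
  set v := (InnerProductSpace.toDual ℝ (H10 Ω)).symm ℓ with hv
  set m := hcoer.continuousLinearEquivOfBilin.symm v with hm
  have hsol : ∀ k : H10 Ω, B m k = -⟪F, (k : GradSpace Ω) 0⟫ := by
    intro k
    rw [← hcoer.continuousLinearEquivOfBilin_apply, hm, ContinuousLinearEquiv.apply_symm_apply, hv,
      InnerProductSpace.toDual_symm_apply]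
    rfl
  have h₀ := hasWeakDeriv_of_mem_H10 hb m.2 0
  have h₁ := hasWeakDeriv_of_mem_H10 hb m.2 1
  refine ⟨(m : GradSpace Ω) 0, memH10_of_mem_H10 hb m.2, h₀.1,
    (MemL2.integrableOn hb hf).locallyIntegrableOn, fun φ => ?_⟩
  have h := hsol ⟨testToGrad φ, testToGrad_mem φ⟩
  rw [hBa] at h
  change ⟪(m : GradSpace Ω) 1, testToL2 _⟫ + ⟪(m : GradSpace Ω) 2, testToL2 _⟫ =
    -⟪F, testToL2 _⟫ at h
  rw [inner_eq_integral ae_eq_rfl (coeFn_testToL2 _),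
    inner_eq_integral ae_eq_rfl (coeFn_testToL2 _),
    inner_eq_integral (MemLp.coeFn_toLp hf) (coeFn_testToL2 _)] at h
  rw [integral_mul_laplacian h₀ h₁]
  exact neg_eq_iff_eq_neg.2 h

/-- The energy estimate for the difference of two weak solutions. -/
theorem SolvesDirichlet.sub_le (hb : Bornology.IsBounded (Ω : Set Plane)) {D : ℝ} (hD : 0 < D)
    (hΩ : ∀ x ∈ (Ω : Set Plane), ∀ y ∈ (Ω : Set Plane), dist x y ≤ D) (hf : MemL2 Ω f)
    (hg : MemL2 Ω g) {w w' : Plane → ℝ} (hw : SolvesDirichlet Ω f w)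
    (hw' : SolvesDirichlet Ω g w') :
    sobolevSeminorm 1 Ω (fun x => w x - w' x) ≤ 2 * D * l2Norm Ω (fun x => f x - g x) ∧
      l2Norm Ω (fun x => w x - w' x) ≤ (2 * D) ^ 2 * l2Norm Ω (fun x => f x - g x) := by
  obtain ⟨m, hm, hm0, hm1, hm2⟩ := hw.1.exists_mem_H10 hb
  obtain ⟨n, hn, hn0, hn1, hn2⟩ := hw'.1.exists_mem_H10 hb
  set k := m - n with hk
  have hkH : k ∈ H10 Ω := Submodule.sub_mem _ hm hn
  have hfg : MemL2 Ω fun x => f x - g x := MemLp.sub hf hg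
  set F : L2 Ω := MemLp.toLp _ hfg with hF
  have hnF : ‖F‖ = l2Norm Ω fun x => f x - g x := norm_toLp_eq_l2Norm hfg
  have hsub : ∀ {x y : L2 Ω} {a b : Plane → ℝ}, x =ᵐ[volume.restrict Ω] a →
      y =ᵐ[volume.restrict Ω] b → ‖x - y‖ = l2Norm Ω fun t => a t - b t := by
    intro x y a b hx hy
    rw [Lp.norm_def, toReal_eLpNorm (Lp.aestronglyMeasurable _)]
    refine l2Norm_congr ?_
    filter_upwards [Lp.coeFn_sub x y, hx, hy] with t h1 h2 h3
    rw [h1, Pi.sub_apply, h2, h3]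
  have hk0 : ‖k 0‖ = l2Norm Ω fun x => w x - w' x := hsub hm0 hn0
  have hL : ∀ (x y : L2 Ω), MemL2 Ω fun a => x a - y a := fun x y =>
    (Lp.memLp x).sub (Lp.memLp y)
  have hk12 : sobolevSeminorm 1 Ω (fun x => w x - w' x) ^ 2 = ‖k 1‖ ^ 2 + ‖k 2‖ ^ 2 := by
    rw [sobolevSeminorm_one_sq (hm1.sub hn1) (hL _ _) (hm2.sub hn2) (hL _ _),
      ← hsub ae_eq_rfl ae_eq_rfl, ← hsub ae_eq_rfl ae_eq_rfl]
    rfl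
  have henergy : ‖k 1‖ ^ 2 + ‖k 2‖ ^ 2 = -⟪F, k 0⟫ := by
    have a1 := inner_grad_eq_neg_inner hf hw.2 hm1 hm2 hkH
    have a2 := inner_grad_eq_neg_inner hg hw'.2 hn1 hn2 hkH
    rw [← real_inner_self_eq_norm_sq, ← real_inner_self_eq_norm_sq]
    have e : ∀ i, k i = m i - n i := fun i => rfl
    have eF : F = (MemLp.toLp f hf : L2 Ω) - MemLp.toLp g hg := rfl
    calc ⟪k 1, k 1⟫ + ⟪k 2, k 2⟫ = (⟪m 1, k 1⟫ + ⟪m 2, k 2⟫) - (⟪n 1, k 1⟫ + ⟪n 2, k 2⟫) := by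
          conv_lhs => rw [e 1, e 2, inner_sub_left, inner_sub_left, ← e 1, ← e 2]
          ring
      _ = _ := by rw [a1, a2, eF, inner_sub_left]; ring
  set S := sobolevSeminorm 1 Ω fun x => w x - w' x with hS
  have hS0 : 0 ≤ S := sobolevSeminorm_nonneg _ _ _
  have hfr : ‖k 0‖ ≤ 2 * D * S := by
    refine le_of_sq_le_sq ?_ (by positivity)
    rw [mul_pow, hk12]
    exact friedrichs hD hΩ hkH
  have hSle : S ≤ 2 * D * ‖F‖ := by
    have h1 : S ^ 2 ≤ ‖F‖ * (2 * D * S) := by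
      rw [hk12, henergy]
      calc -⟪F, k 0⟫ ≤ ‖F‖ * ‖k 0‖ := (neg_le_abs _).trans (abs_real_inner_le_norm _ _)
        _ ≤ _ := by gcongr
    -- The inequality S² ≤ 2D‖F‖S is divided by S, hence the separate case S = 0.
    rcases hS0.eq_or_lt with h0 | h0
    · rw [← h0]; positivity
    · refine le_of_mul_le_mul_right ?_ h0
      linarith
  rw [← hnF, ← hk0]
  refine ⟨hSle, hfr.trans ?_⟩
  rw [sq, mul_assoc (2 * D) (2 * D)]
  gcongr

end WeakSolutions

/-! ### The L² projection on polynomials -/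

section Projection

open scoped RealInnerProductSpace

open MvPolynomial

variable {Ω : Opens Plane} {g : Plane → ℝ}

lemma memL2_polyFun (hb : Bornology.IsBounded (Ω : Set Plane)) (q : MvPolynomial (Fin 2) ℝ) :
    MemL2 Ω (polyFun q) := (contDiff_polyFun q).continuous.memL2 hb

/-- Polynomials as elements of `L²(Ω)`. -/
noncomputable def polyToL2 (hb : Bornology.IsBounded (Ω : Set Plane)) :
    MvPolynomial (Fin 2) ℝ →ₗ[ℝ] L2 Ω where
  toFun q := MemLp.toLp (polyFun q) (memL2_polyFun hb q)
  map_add' p q := by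
    have hp : MemLp (polyFun p) 2 (volume.restrict (Ω : Set Plane)) := memL2_polyFun hb p
    have hq : MemLp (polyFun q) 2 (volume.restrict (Ω : Set Plane)) := memL2_polyFun hb q
    have h := MemLp.toLp_congr (memL2_polyFun hb (p + q)) (hp.add hq)
      (ae_of_all _ (congrFun (polyFun_add p q)))
    exact h.trans (MemLp.toLp_add hp hq)
  map_smul' c q := by
    have hq : MemLp (polyFun q) 2 (volume.restrict (Ω : Set Plane)) := memL2_polyFun hb q
    have h := MemLp.toLp_congr (memL2_polyFun hb (c • q)) (hq.const_smul c)
      (ae_of_all _ (congrFun (polyFunₗ.map_smul c q)))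
    exact h.trans (MemLp.toLp_const_smul c hq)

lemma inner_sub_polyToL2 (hb : Bornology.IsBounded (Ω : Set Plane)) (hg : MemL2 Ω g)
    (q φ : MvPolynomial (Fin 2) ℝ) :
    ⟪(MemLp.toLp g hg : L2 Ω) - polyToL2 hb q, polyToL2 hb φ⟫ =
      ∫ x in Ω, (g x - polyFun q x) * polyFun φ x := by
  refine inner_eq_integral ?_ (MemLp.coeFn_toLp (memL2_polyFun hb φ))
  filter_upwards [Lp.coeFn_sub (MemLp.toLp g hg : L2 Ω) (polyToL2 hb q), MemLp.coeFn_toLp hg,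
    MemLp.coeFn_toLp (memL2_polyFun hb q)] with x h1 h2 h3
  rw [h1, Pi.sub_apply, h2]
  exact congrArg _ h3

lemma exists_isL2Projection (hb : Bornology.IsBounded (Ω : Set Plane)) (m : ℤ) (hg : MemL2 Ω g) :
    ∃ q, IsL2Projection Ω m g q := by
  have hfin : Finite {d : Fin 2 →₀ ℕ | (d.degree : ℤ) ≤ m} := by
    refine Set.Finite.subset (Finsupp.finite_of_degree_le m.toNat) fun d hd => ?_
    have hd : (d.degree : ℤ) ≤ m := hd
    change d.degree ≤ m.toNat
    omega
  have : Module.Finite ℝ (restrictSupport ℝ {d : Fin 2 →₀ ℕ | (d.degree : ℤ) ≤ m}) :=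
    Module.Finite.of_basis (basisRestrictSupport ℝ _)
  set W := (restrictSupport ℝ {d : Fin 2 →₀ ℕ | (d.degree : ℤ) ≤ m}).map (polyToL2 hb)
  obtain ⟨w, hw, hort⟩ := Submodule.HasOrthogonalProjection.exists_orthogonal (K := W)
    (MemLp.toLp g hg : L2 Ω)
  obtain ⟨q, hq, rfl⟩ := hw
  refine ⟨q, by rw [polysDegreeLE_eq]; exact hq, fun φ hφ => ?_⟩
  rw [polysDegreeLE_eq] at hφ
  rw [← inner_sub_polyToL2 hb hg]
  exact (Submodule.mem_orthogonal' _ _).1 hort _ ⟨φ, hφ, rfl⟩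

lemma IsL2Projection.l2Norm_sub_le (hb : Bornology.IsBounded (Ω : Set Plane)) {m : ℤ}
    (hg : MemL2 Ω g) {q r : MvPolynomial (Fin 2) ℝ} (hq : IsL2Projection Ω m g q)
    (hr : r ∈ polysDegreeLE m) :
    l2Norm Ω (fun x => g x - polyFun q x) ≤ l2Norm Ω fun x => g x - polyFun r x := by
  have hn : ∀ r, l2Norm Ω (fun x => g x - polyFun r x) =
      ‖(MemLp.toLp g hg : L2 Ω) - polyToL2 hb r‖ := fun r =>
    (norm_toLp_eq_l2Norm (MemLp.sub hg (memL2_polyFun hb r))).symm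
  rw [hn, hn]
  set G : L2 Ω := MemLp.toLp g hg
  have hqr : q - r ∈ polysDegreeLE m := by
    have hq1 := hq.1
    rw [polysDegreeLE_eq] at hq1 hr ⊢
    exact Submodule.sub_mem _ hq1 hr
  have h0 : ⟪G - polyToL2 hb q, polyToL2 hb (q - r)⟫ = 0 :=
    (inner_sub_polyToL2 hb hg q (q - r)).trans (hq.2 _ hqr)
  have h1 : G - polyToL2 hb r = (G - polyToL2 hb q) + polyToL2 hb (q - r) := by
    rw [map_sub]; abel
  refine le_of_sq_le_sq ?_ (norm_nonneg _)
  rw [h1, norm_add_sq_real, h0]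
  -- Pythagoras: the cross term vanishes by orthogonality.
  nlinarith [sq_nonneg ‖polyToL2 hb (q - r)‖]

end Projection

/-! ### Diameters and the final estimate -/

open scoped Pointwise in
lemma diam_rescale (z : Plane) {s : ℝ} (hs : 0 ≤ s) (K : Set Plane) :
    Metric.diam (rescale z s K) = s * Metric.diam K := by
  have h : rescale z s K = (fun y => z + y) '' (s • K) := by
    rw [rescale, ← image_smul, image_image]
  rw [h, (isometry_add_left z).diam_image, diam_smul₀, Real.norm_of_nonneg hs]

end CurvedFEM

theorem mainTheorem3 (p : ℕ) (hp : 1 ≤ p) (K₀ : Set CurvedFEM.Plane)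
    (hK₀ : CurvedFEM.IsMeshCell K₀) :
    ∃ c : ℝ, 0 < c ∧ ∀ (z : CurvedFEM.Plane) (s : ℝ), 0 < s →
      ∀ (K : Set CurvedFEM.Plane), K = CurvedFEM.rescale z s K₀ →
      ∀ (Ω : TopologicalSpace.Opens CurvedFEM.Plane), Ω = TopologicalSpace.Opens.interior K →
      ∀ v Δv : CurvedFEM.Plane → ℝ,
        CurvedFEM.MemH 1 Ω v → CurvedFEM.HasWeakLaplacian Ω v Δv → CurvedFEM.MemH (p - 1) Ω Δv →
        (∃ vK, CurvedFEM.SolvesDirichlet Ω Δv vK) ∧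
        (∃ Iv, CurvedFEM.IsInteriorInterpolant Ω p Δv Iv) ∧
        ∀ vK Iv : CurvedFEM.Plane → ℝ,
          CurvedFEM.SolvesDirichlet Ω Δv vK → CurvedFEM.IsInteriorInterpolant Ω p Δv Iv →
          CurvedFEM.sobolevSeminorm 1 Ω (fun x => vK x - Iv x) ≤
              c * Metric.diam K ^ p * CurvedFEM.sobolevSeminorm (p - 1) Ω Δv ∧
          CurvedFEM.l2Norm Ω (fun x => vK x - Iv x) ≤
              c * Metric.diam K ^ (p + 1) * CurvedFEM.sobolevSeminorm (p - 1) Ω Δv := by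
  open CurvedFEM in
  obtain ⟨C, hC0, hC⟩ := exists_polynomial_approximation hK₀.lipschitz hK₀.connected
    hK₀.interior_nonempty hK₀.compact_closure (p - 1)
  have hdiam₀ : 0 < Metric.diam K₀ := by
    have hb : Bornology.IsBounded K₀ := hK₀.compact_closure.isBounded.subset subset_closure
    refine Metric.diam_pos ?_ hb
    by_contra hns
    rw [not_nontrivial_iff] at hns
    obtain ⟨x, hx⟩ := hK₀.interior_nonempty
    have h1 : interior K₀ = {x} :=
      (hns.anti interior_subset).eq_singleton_of_mem hx
    have h2 : IsOpen ({x} : Set Plane) := h1 ▸ isOpen_interior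
    exact not_isOpen_singleton x h2
  -- Dividing by the power of the diameter of K₀ converts s^(p-1) into the power of the diameter of
  -- K. The 4 is the (2h)² of the L² estimate and also covers the 2h of the energy estimate; the 1
  -- ensures positivity when C = 0.
  refine ⟨4 * (C / Metric.diam K₀ ^ (p - 1)) + 1, by positivity, ?_⟩
  intro z s hs K hK Ω hΩ v Δv _ _ hΔv
  have hdiam : Metric.diam K = s * Metric.diam K₀ := hK ▸ diam_rescale z hs.le K₀
  have hbK : Bornology.IsBounded K := hK ▸ isBounded_rescale hK₀.compact_closure z s
  have hΩK : (Ω : Set Plane) ⊆ K := by rw [hΩ]; exact interior_subset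
  have hb := hbK.subset hΩK
  have hD : 0 < Metric.diam K := by rw [hdiam]; positivity
  have hdist : ∀ x ∈ (Ω : Set Plane), ∀ y ∈ (Ω : Set Plane), dist x y ≤ Metric.diam K :=
    fun x hx y hy => Metric.dist_le_diam_of_mem hbK (hΩK hx) (hΩK hy)
  refine ⟨exists_solvesDirichlet hb hD hdist hΔv.1, ?_, ?_⟩
  · obtain ⟨q, hq⟩ := exists_isL2Projection hb ((p : ℤ) - 2) hΔv.1
    obtain ⟨w, hw⟩ := exists_solvesDirichlet hb hD hdist (memL2_polyFun hb q)
    exact ⟨w, q, hq, hw⟩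
  · rintro vK Iv hvK ⟨q, hq, hIv⟩
    obtain ⟨r, hr, hle⟩ := hC z s hs Ω (hK ▸ hΩ) Δv hΔv
    -- Order p − 1 in Deny–Lions gives exactly the degree p − 2 of the projection; `hp` makes the
    -- truncated subtraction harmless.
    have hcast : ((p - 1 : ℕ) : ℤ) - 1 = (p : ℤ) - 2 := by omega
    rw [hcast] at hr
    have hproj := (hq.l2Norm_sub_le hb hΔv.1 hr).trans hle
    obtain ⟨h1, h2⟩ := hvK.sub_le hb hD hdist hΔv.1 (memL2_polyFun hb q) hIv
    set S := sobolevSeminorm (p - 1) Ω Δv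
    have hS : 0 ≤ S := sobolevSeminorm_nonneg _ _ _
    set d := Metric.diam K with hd
    set A := C / Metric.diam K₀ ^ (p - 1) with hA
    have hA0 : 0 ≤ A := by positivity
    have hs' : C * s ^ (p - 1) = A * d ^ (p - 1) := by
      rw [hA, hdiam, mul_pow]
      field_simp
    rw [hs'] at hproj
    obtain ⟨k, rfl⟩ : ∃ k, p = k + 1 := ⟨p - 1, by omega⟩
    simp only [Nat.add_sub_cancel] at hproj
    have hk : 0 ≤ d ^ k * S := by positivity
    constructor
    · calc _ ≤ 2 * d * (A * d ^ k * S) := h1.trans (by gcongr)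
        _ = 2 * A * (d ^ (k + 1) * S) := by ring
        _ ≤ (4 * A + 1) * (d ^ (k + 1) * S) := by gcongr; linarith
        _ = _ := by ring
    · calc _ ≤ (2 * d) ^ 2 * (A * d ^ k * S) := h2.trans (by gcongr)
        _ = 4 * A * (d ^ (k + 1 + 1) * S) := by ring
        _ ≤ (4 * A + 1) * (d ^ (k + 1 + 1) * S) := by gcongr; linarith
        _ = _ := by ring
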